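/- Let $n\ge 5$ and let $G=G_1*\dots*G_n$ be the free product of non-trivial subgroups $G_1,\dots,G_n$. Write $H^g=g^{-1}Hg$. **Trees.** Consider the following finite trees with a basepoint. Each has exactly $n$ non-trivial vertices, named $1,\dots,n$; all other vertices are trivial. The indices $i,j,k,l,m$ are distinct elements of $\{1,\dots,n\}$, and every name that is not mentioned is a leaf adjacent to the basepoint. - $\alpha$: the basepoint is trivial. $A_i$: the basepoint is $i$. - $\rho_{ij}$: the basepoint is trivial, and adjacent to a trivial vertex with leaves $i,j$. - $\beta_{i,j}$: the basepoint is trivial, and adjacent to $i$, which is adjacent to the leaf $j$. - $\gamma_{i,jk}$: the basepoint is $i$, and adjacent to a trivial vertex with leaves $j,k$. - $B_{i,j,k}$: the basepoint is $i$, and adjacent to $j$, which is adjacent to the leaf $k$. - $\sigma_{i,jk,lm}$: the basepoint is $i$, and adjacent to two trivial vertices, one with leaves $j,k$ and one with leaves $l,m$. - $\tau_{i,j,kl}$: the basepoint is trivial, and adjacent to $i$, which is adjacent to the leaf $j$, and to a trivial vertex with leaves $k,l$. - $\delta_{i,j,k,lm}$: the basepoint is $i$, and adjacent to $j$, which is adjacent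 to the leaf $k$, and to a trivial vertex with leaves $l,m$. - $\varepsilon_{i,j,k,l}$: the basepoint is trivial, and adjacent to $i$ and $k$, which are adjacent to the leaves $j$ and $l$ respectively. - $C_{i,j,k,l,m}$: the basepoint is $i$, and adjacent to $j$ and $l$, which are adjacent to the leaves $k$ and $m$ respectively. **Labelled trees.** A labelling of such a tree assigns to the vertex named $i$ a subgroup $H_i=G_i^{g_i}$ for some $g_i\in G$, for $i=1,\dots,n$, such that $G$ is the free product of $H_1,\dots,H_n$; trivial vertices $v$ get the group $H_v=\{1\}$. Two labelled trees, with vertex groups $(H_v)$ and $(H'_v)$, are equivalent if, after identifying the underlying trees by an isomorphism that preserves names and basepoints, there are $g_v\in G$ with $H'_v=g_v^{-1}H_vg_v$ for every vertex $v$ and $g_{t(e)}g_{o(e)}^{-1}\in H_{o(e)}$ for every edge $e$, where $o(e)$ is the endpoint of $e$ closer to the basepoint and $t(e)$ is the other one. A labelled tree collapses to another one if the second is obtained from the first by successively contracting edges that have at least one trivial endpoint; the merged vertex receives the name and the vertex group of the non-trivial endpoint, if there is one, and is trivial otherwise, and the merged vertex is the basepoint if one of the two endpoints is. **The complexes.**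 Let $\mathcal C_n$ be the simplicial complex whose vertices are the equivalence classes of labelled trees, where two distinct vertices span an edge if and only if some representative of one of them collapses to some representative of the other, and three distinct vertices span a triangle if and only if they pairwise span edges; there are no simplices of dimension greater than $2$. Let $\mathcal D_n$ be the subcomplex of $\mathcal C_n$ consisting of all simplices each of whose vertices is represented by a labelled tree with $H_i=G_i$ for all $i$. ($\mathcal D_n$ is the fundamental domain for the action on $\mathcal C_n$ of the group of outer automorphisms of $G$ that preserve the conjugacy class of each $G_i$.) **Theorem.** The geometric realization of $\mathcal D_n$ is simply connected (in particular non-empty and path connected). -/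

import Mathlib

/-! ### Free splittings -/

/-- The subgroups `H i` form an internal free product decomposition of `G`: the canonical map
from the free product of the `H i` to `G` is bijective. -/
def IsInternalFreeProduct {G : Type*} [Group G] {n : ℕ} (H : Fin n → Subgroup G) : Prop :=
  Function.Bijective (Monoid.CoprodI.lift (fun i => (H i).subtype))

/-- The conjugate `H ^ g = g⁻¹ H g`. -/
def conjSubgroup {G : Type*} [Group G] (g : G) (H : Subgroup G) : Subgroup G :=
  H.map (MulAut.conj g⁻¹).toMonoidHom

/-- `H` is an `S` free factor splitting of `G`: each `H i` is a conjugate of `S i`, and `G` is the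
free product of the `H i`. -/
def IsFreeFactorSplitting {G : Type*} [Group G] {n : ℕ} (S H : Fin n → Subgroup G) : Prop :=
  (∀ i, ∃ g : G, H i = conjSubgroup g (S i)) ∧ IsInternalFreeProduct H

/-! ### Trees with a basepoint -/

/-- A finite tree with a basepoint, having `n` vertices `Sum.inl 0, …, Sum.inl (n - 1)`
(which will carry the vertex groups) and `k` further vertices `Sum.inr _`, the trivial ones.
The tree is given by its basepoint `base` and the map `parent` that sends each vertex other than
the basepoint to the next vertex on the way to the basepoint; so the edges are the pairs
`{v, parent v}` with `v ≠ base`, and `parent v` is the endpoint that is closer to `base`. -/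
structure BasedTree (n : ℕ) where
  k : ℕ
  base : Fin n ⊕ Fin k
  parent : Fin n ⊕ Fin k → Fin n ⊕ Fin k
  parent_base : parent base = base
  reaches_base : ∀ v, ∃ m : ℕ, parent^[m] v = base

namespace BasedTree

variable {n : ℕ}

abbrev Vertex (T : BasedTree n) : Type := Fin n ⊕ Fin T.k

/-- An isomorphism of based trees that preserves the names of the `n` named vertices. -/
structure IsIso (T T' : BasedTree n) (f : T.Vertex ≃ T'.Vertex) : Prop where
  map_named : ∀ i : Fin n, f (Sum.inl i) = Sum.inl i
  map_base : f T.base = T'.base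
  map_parent : ∀ v, f (T.parent v) = T'.parent (f v)

/-- `T'` is (isomorphic to) the tree obtained from `T` by collapsing a single edge `{e, parent e}`
which has at least one trivial endpoint. The map `f` is the collapsing map: it identifies the two
endpoints of that edge and nothing else, and it sends all other edges to edges. The new vertex
carries the name of the endpoint that is named, if there is one. -/
def IsEdgeCollapse (T T' : BasedTree n) : Prop :=
  ∃ (e : T.Vertex) (f : T.Vertex → T'.Vertex),
    e ≠ T.base ∧
    (e.isRight ∨ (T.parent e).isRight) ∧
    Function.Surjective f ∧
    (∀ u v, f u = f v ↔ u = v ∨ (u = e ∧ v = T.parent e) ∨ (u = T.parent e ∧ v = e)) ∧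
    (∀ i : Fin n, f (Sum.inl i) = Sum.inl i) ∧
    f T.base = T'.base ∧
    (∀ v, v ≠ e → f (T.parent v) = T'.parent (f v))

/-- `T'` is a collapse of `T`: it is the result of successively collapsing edges. -/
def IsCollapse (T T' : BasedTree n) : Prop :=
  Relation.ReflTransGen IsEdgeCollapse T T'

/-- A based tree all of whose vertices are at distance at most two from the basepoint. -/
def ofDepthTwo (k : ℕ) (base : Fin n ⊕ Fin k) (parent : Fin n ⊕ Fin k → Fin n ⊕ Fin k)
    (hb : parent base = base) (h : ∀ v, parent (parent v) = base) : BasedTree n where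
  k := k
  base := base
  parent := parent
  parent_base := hb
  reaches_base v := ⟨2, h v⟩

/-! The shapes of trees. The indices `i, j, k, l, m` are distinct: they are the values `e 0`, `e 1`,
`e 2`, `e 3`, `e 4` of an injective map `e`. Every named vertex that is not mentioned is a leaf
adjacent to the basepoint. -/

/-- `α`: the basepoint is trivial, and all named vertices are leaves adjacent to it. -/
def alpha : BasedTree n :=
  ofDepthTwo 1 (Sum.inr 0) (fun _ => Sum.inr 0) rfl (fun _ => rfl)

/-- `A_i`: the basepoint is `i`. -/
def A (e : Fin 1 ↪ Fin n) : BasedTree n :=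
  ofDepthTwo 0 (Sum.inl (e 0)) (fun _ => Sum.inl (e 0)) rfl (fun _ => rfl)

/-- `ρ_{ij}`: the basepoint is trivial, and adjacent to a trivial vertex with leaves `i` and `j`. -/
def rho (e : Fin 2 ↪ Fin n) : BasedTree n :=
  ofDepthTwo 2 (Sum.inr 0)
    (Sum.elim (fun v => if v = e 0 ∨ v = e 1 then Sum.inr 1 else Sum.inr 0) (fun _ => Sum.inr 0))
    rfl (by rintro (v | v) <;> grind)

/-- `β_{i,j}`: the basepoint is trivial, and adjacent to `i`, which is adjacent to the leaf `j`. -/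
def beta (e : Fin 2 ↪ Fin n) : BasedTree n :=
  ofDepthTwo 1 (Sum.inr 0)
    (Sum.elim (fun v => if v = e 1 then Sum.inl (e 0) else Sum.inr 0) (fun _ => Sum.inr 0))
    rfl (by rintro (v | v) <;> grind)

/-- `γ_{i,jk}`: the basepoint is `i`, and adjacent to a trivial vertex with leaves `j` and `k`. -/
def gamma (e : Fin 3 ↪ Fin n) : BasedTree n :=
  ofDepthTwo 1 (Sum.inl (e 0))
    (Sum.elim (fun v => if v = e 1 ∨ v = e 2 then Sum.inr 0 else Sum.inl (e 0))
      (fun _ => Sum.inl (e 0)))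
    (by simp)
    (by rintro (v | v) <;> grind)

/-- `B_{i,j,k}`: the basepoint is `i`, and adjacent to `j`, which is adjacent to the leaf `k`. -/
def B (e : Fin 3 ↪ Fin n) : BasedTree n :=
  ofDepthTwo 0 (Sum.inl (e 0))
    (Sum.elim (fun v => if v = e 2 then Sum.inl (e 1) else Sum.inl (e 0))
      (fun _ => Sum.inl (e 0)))
    (by simp)
    (by rintro (v | v) <;> grind)

/-- `σ_{i,jk,lm}`: the basepoint is `i`, and adjacent to two trivial vertices, the first with
leaves `j` and `k`, the second with leaves `l` and `m`. -/
def sigma (e : Fin 5 ↪ Fin n) : BasedTree n :=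
  ofDepthTwo 2 (Sum.inl (e 0))
    (Sum.elim
      (fun v => if v = e 1 ∨ v = e 2 then Sum.inr 0 else
        if v = e 3 ∨ v = e 4 then Sum.inr 1 else Sum.inl (e 0))
      (fun _ => Sum.inl (e 0)))
    (by simp)
    (by rintro (v | v) <;> grind)

/-- `τ_{i,j,kl}`: the basepoint is trivial, and adjacent to `i`, which is adjacent to the leaf `j`,
and to a trivial vertex with leaves `k` and `l`. -/
def tau (e : Fin 4 ↪ Fin n) : BasedTree n :=
  ofDepthTwo 2 (Sum.inr 0)
    (Sum.elim
      (fun v => if v = e 1 then Sum.inl (e 0) else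
        if v = e 2 ∨ v = e 3 then Sum.inr 1 else Sum.inr 0)
      (fun _ => Sum.inr 0))
    rfl (by rintro (v | v) <;> grind)

/-- `δ_{i,j,k,lm}`: the basepoint is `i`, and adjacent to `j`, which is adjacent to the leaf `k`,
and to a trivial vertex with leaves `l` and `m`. -/
def delta (e : Fin 5 ↪ Fin n) : BasedTree n :=
  ofDepthTwo 1 (Sum.inl (e 0))
    (Sum.elim
      (fun v => if v = e 2 then Sum.inl (e 1) else
        if v = e 3 ∨ v = e 4 then Sum.inr 0 else Sum.inl (e 0))
      (fun _ => Sum.inl (e 0)))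
    (by simp)
    (by rintro (v | v) <;> grind)

/-- `ε_{i,j,k,l}`: the basepoint is trivial, and adjacent to `i` and `k`, which are adjacent to the
leaves `j` and `l`, respectively. -/
def epsilon (e : Fin 4 ↪ Fin n) : BasedTree n :=
  ofDepthTwo 1 (Sum.inr 0)
    (Sum.elim
      (fun v => if v = e 1 then Sum.inl (e 0) else if v = e 3 then Sum.inl (e 2) else Sum.inr 0)
      (fun _ => Sum.inr 0))
    rfl (by rintro (v | v) <;> grind)

/-- `C_{i,j,k,l,m}`: the basepoint is `i`, and adjacent to `j` and `l`, which are adjacent to the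
leaves `k` and `m`, respectively. -/
def C (e : Fin 5 ↪ Fin n) : BasedTree n :=
  ofDepthTwo 0 (Sum.inl (e 0))
    (Sum.elim
      (fun v => if v = e 2 then Sum.inl (e 1) else
        if v = e 4 then Sum.inl (e 3) else Sum.inl (e 0))
      (fun _ => Sum.inl (e 0)))
    (by simp)
    (by rintro (v | v) <;> grind)

/-- The trees that occur as underlying trees of the vertices of `C_n`. -/
inductive InTable : BasedTree n → Prop
  | alpha : InTable alpha
  | A (e : Fin 1 ↪ Fin n) : InTable (A e)
  | rho (e : Fin 2 ↪ Fin n) : InTable (rho e)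
  | beta (e : Fin 2 ↪ Fin n) : InTable (beta e)
  | gamma (e : Fin 3 ↪ Fin n) : InTable (gamma e)
  | B (e : Fin 3 ↪ Fin n) : InTable (B e)
  | sigma (e : Fin 5 ↪ Fin n) : InTable (sigma e)
  | tau (e : Fin 4 ↪ Fin n) : InTable (tau e)
  | delta (e : Fin 5 ↪ Fin n) : InTable (delta e)
  | epsilon (e : Fin 4 ↪ Fin n) : InTable (epsilon e)
  | C (e : Fin 5 ↪ Fin n) : InTable (C e)

end BasedTree

/-! ### Labelled trees (graphs of groups) and their equivalence -/

/-- A tree from the table with an `S`-labelling, that is, a graph of groups whose vertex groups are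
`label i` at the `i`-th named vertex and trivial elsewhere, and whose edge groups are trivial. -/
structure LabelledTree {G : Type*} [Group G] {n : ℕ} (S : Fin n → Subgroup G) where
  tree : BasedTree n
  inTable : tree.InTable
  label : Fin n → Subgroup G
  isSplitting : IsFreeFactorSplitting S label

namespace LabelledTree

variable {G : Type*} [Group G] {n : ℕ} {S : Fin n → Subgroup G}

def vertexGroup (P : LabelledTree S) : P.tree.Vertex → Subgroup G :=
  Sum.elim P.label (fun _ => ⊥)

/-- Equivalence of labelled trees: up to an isomorphism `f` of the underlying trees, the vertex
groups are related by `H'_v = g_v⁻¹ H_v g_v`, where `g_{t(e)} g_{o(e)}⁻¹ ∈ H_{o(e)}` for each edge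
`e = {v, parent v}` with `t(e) = v` and `o(e) = parent v`; in particular `g_{t(e)} = g_{o(e)}` if
`o(e)` is trivial. (An automorphism of `H_v` maps `H_v` onto itself, so inserting one, as in
`H'_v = g_v⁻¹ φ_v(H_v) g_v`, changes nothing.) -/
def Equivalent (P Q : LabelledTree S) : Prop :=
  ∃ f : P.tree.Vertex ≃ Q.tree.Vertex, BasedTree.IsIso P.tree Q.tree f ∧
    ∃ g : P.tree.Vertex → G,
      (∀ v, Q.vertexGroup (f v) = conjSubgroup (g v) (P.vertexGroup v)) ∧
      (∀ v, v ≠ P.tree.base →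
        g v * (g (P.tree.parent v))⁻¹ ∈ P.vertexGroup (P.tree.parent v))

theorem mem_conjSubgroup {g x : G} {H : Subgroup G} :
    x ∈ conjSubgroup g H ↔ g * x * g⁻¹ ∈ H := by
  constructor
  · rintro ⟨h, hh, rfl⟩
    have h1 : g * (g⁻¹ * h * g) * g⁻¹ = h := by group
    simpa [h1] using hh
  · intro h
    refine ⟨g * x * g⁻¹, h, ?_⟩
    simp [mul_assoc]

theorem Equivalent.refl (P : LabelledTree S) : Equivalent P P := by
  refine ⟨Equiv.refl _, ⟨fun _ => rfl, rfl, fun _ => rfl⟩, fun _ => 1, fun v => ?_, fun v _ => ?_⟩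
  · ext x
    simp [mem_conjSubgroup]
  · simp

theorem Equivalent.symm {P Q : LabelledTree S} (h : Equivalent P Q) : Equivalent Q P := by
  obtain ⟨f, ⟨h1, h2, h3⟩, g, hg, he⟩ := h
  have hp : ∀ w, f.symm (Q.tree.parent w) = P.tree.parent (f.symm w) := by
    intro w
    rw [Equiv.symm_apply_eq, h3, Equiv.apply_symm_apply]
  refine ⟨f.symm, ⟨fun i => ?_, ?_, hp⟩, fun w => (g (f.symm w))⁻¹, fun w => ?_, fun w hw => ?_⟩
  · rw [Equiv.symm_apply_eq, h1]
  · rw [Equiv.symm_apply_eq, h2]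
  · ext x
    have := hg (f.symm w)
    rw [Equiv.apply_symm_apply] at this
    rw [this, mem_conjSubgroup, mem_conjSubgroup]
    simp [mul_assoc]
  · have hw' : f.symm w ≠ P.tree.base := by
      intro h
      exact hw (by rw [← h2, ← h, Equiv.apply_symm_apply])
    have h4 := he _ hw'
    have h5 := hg (f.symm (Q.tree.parent w))
    rw [Equiv.apply_symm_apply] at h5
    rw [h5, mem_conjSubgroup, hp]
    have := inv_mem h4
    simpa [mul_assoc, hp] using this

theorem Equivalent.trans {P Q R : LabelledTree S} (h : Equivalent P Q) (h' : Equivalent Q R) :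
    Equivalent P R := by
  obtain ⟨f, ⟨h1, h2, h3⟩, g, hg, he⟩ := h
  obtain ⟨f', ⟨h1', h2', h3'⟩, g', hg', he'⟩ := h'
  refine ⟨f.trans f', ⟨fun i => ?_, ?_, fun v => ?_⟩, fun v => g v * g' (f v), fun v => ?_,
    fun v hv => ?_⟩
  · simp [h1, h1']
  · simp [h2, h2']
  · simp [h3, h3']
  · ext x
    simp only [Equiv.trans_apply]
    rw [hg', hg, mem_conjSubgroup, mem_conjSubgroup, mem_conjSubgroup]
    simp [mul_assoc]
  · have hv' : f v ≠ Q.tree.base := by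
      rw [← h2]
      exact fun h => hv (f.injective h)
    have h4 := he v hv
    have h5 := he' (f v) hv'
    rw [← h3, hg, mem_conjSubgroup] at h5
    have := mul_mem h4 h5
    simpa [mul_assoc] using this

instance setoid (S : Fin n → Subgroup G) : Setoid (LabelledTree S) where
  r := Equivalent
  iseqv := ⟨Equivalent.refl, Equivalent.symm, Equivalent.trans⟩

/-- `Q` is a collapse of `P`: the tree of `Q` is a collapse of the tree of `P`, and the vertex
groups of the named vertices are unchanged (since `{1} * H = H`). -/
def IsCollapse (P Q : LabelledTree S) : Prop :=
  P.tree.IsCollapse Q.tree ∧ Q.label = P.label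

end LabelledTree

/-! ### The complex `C_n` and its subcomplex `D_n` -/

section Complexes

variable {G : Type*} [Group G] {n : ℕ}

/-- The vertices of `C_n`: equivalence classes of labelled trees. -/
abbrev CVertex (S : Fin n → Subgroup G) := Quotient (LabelledTree.setoid S)

/-- Some representative of `w` is a collapse of some representative of `v`. -/
def CollapsesTo {S : Fin n → Subgroup G} (v w : CVertex S) : Prop :=
  ∃ P Q : LabelledTree S, (⟦P⟧ : CVertex S) = v ∧ (⟦Q⟧ : CVertex S) = w ∧ P.IsCollapse Q

/-- The complex `C_n`: two distinct vertices span an edge if one of them collapses to the other, and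
three distinct vertices span a triangle if any two of them span an edge. -/
def complexC (S : Fin n → Subgroup G) : AbstractSimplicialComplex (CVertex S) where
  faces := {s | s.Nonempty ∧ s.card ≤ 3 ∧
    (s : Set (CVertex S)).Pairwise (fun v w => CollapsesTo v w ∨ CollapsesTo w v)}
  isRelLowerSet_faces := by
    rintro s ⟨hs, hc, hp⟩
    refine ⟨hs, fun t hts ht => ⟨ht, (Finset.card_le_card hts).trans hc, ?_⟩⟩
    exact hp.mono (Finset.coe_subset.mpr hts)
  singleton_mem v := by
    refine ⟨Finset.singleton_nonempty v, by simp, ?_⟩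
    simp

/-- The vertices of `D_n`: classes of labelled trees that have a representative whose vertex groups
are the given factors themselves (the `i`-th factor at the `i`-th named vertex; all positions of
the names in the tree are allowed). -/
def domainVertices (S : Fin n → Subgroup G) : Set (CVertex S) :=
  {v | ∃ P : LabelledTree S, (⟦P⟧ : CVertex S) = v ∧ P.label = S}

/-- `D_n`: the subcomplex of `C_n` of all cells whose vertices lie in `domainVertices`. -/
def domainD (S : Fin n → Subgroup G) : PreAbstractSimplicialComplex (CVertex S) where
  faces := {s | s ∈ (complexC S).faces ∧ ∀ v ∈ s, v ∈ domainVertices S}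
  isRelLowerSet_faces := by
    rintro s ⟨hs, hd⟩
    have h := (complexC S).isRelLowerSet_faces hs
    exact ⟨h.1, fun t hts ht => ⟨h.2 hts ht, fun v hv => hd v (hts hv)⟩⟩

end Complexes

/-! ### Geometric realization -/

section Realization

/-- The points of the geometric realization of a simplicial complex, in barycentric coordinates. -/
def Realization {V : Type*} (K : PreAbstractSimplicialComplex V) : Type _ :=
  {x : V → ℝ // (∀ v, 0 ≤ x v) ∧ ∃ s ∈ K.faces, (∀ v, v ∉ s → x v = 0) ∧ ∑ v ∈ s, x v = 1}

/-- The closed simplex of the realization spanned by `s`. -/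
def closedSimplex {V : Type*} (K : PreAbstractSimplicialComplex V) (s : Finset V) :
    Set (Realization K) :=
  {x | ∀ v, v ∉ s → x.1 v = 0}

/-- The weak topology: a set is open if and only if its intersection with each closed simplex is
open in that simplex, which carries the topology of the barycentric coordinates. -/
instance {V : Type*} (K : PreAbstractSimplicialComplex V) : TopologicalSpace (Realization K) :=
  ⨆ s : K.faces, TopologicalSpace.coinduced
    (Subtype.val : closedSimplex K s.1 → Realization K)
    (TopologicalSpace.induced (fun y v => y.1.1 v) Pi.topologicalSpace)

end Realization

/-! ### A nerve criterion for simple connectivity -/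

section Cover

open Set

variable {X : Type*} [TopologicalSpace X]

/-! A complex is simply connected as soon as every local system on it has a global section through
each point of one fibre. The local system to test has as its fibre over a vertex the homotopy
classes of paths from a fixed basepoint into the open star of that vertex. Stars of faces are
star-shaped in barycentric coordinates, so simply connected, and stars of vertices meet exactly in
stars of faces; hence transport along edges exists and is consistent on triangles. A global section
selects, for each point, one class of paths from the basepoint, compatibly with moving the point. It
then determines the class of every path from its endpoints (`simplyConnectedSpace_of_agree`,
`Realization.simplyConnectedSpace_of_sections`).

In the fundamental domain all labels can be taken to be the given factors, so equivalence classes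
are isomorphism classes of trees and edges are collapses of trees (`Code.collapsesTo_vertex_iff`).
The group disappears and a finite combinatorial problem remains.

A section is built by transport along a spanning tree of edges, starting at `alpha`. Each further
edge is then the third side of a triangle `p` > `q` > `r` of collapses whose other two sides are
already settled. For example, `rho` > `alpha` > `A` settles `rho`–`A`, which settles `rho`–`beta`
and `rho`–`gamma` through `A`; these settle `beta`–`B` by the two routes from `rho` to `B`. Maximal
trees `sigma`, `tau` play the same role for the edges at `delta`, `epsilon` and `C`
(`Code.Propagates`, `Code.exists_section`).

A tree can have several codes, so the argument works with codes, and codes of isomorphic trees are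
treated as joined by an edge (`Code.sym_of_isomorphic`, `Propagates.of_isomorphic`). -/

theorem IsSimplyConnected.homotopic_of_mem {U : Set X} (hU : IsSimplyConnected U) {y z : X}
    (p q : Path y z) (hp : ∀ t, p t ∈ U) (hq : ∀ t, q t ∈ U) : p.Homotopic q := by
  have := hU.simplyConnectedSpace
  have hy : y ∈ U := by simpa using hp 0
  have hz : z ∈ U := by simpa using hp 1
  let p' : Path (⟨y, hy⟩ : U) ⟨z, hz⟩ :=
    { toFun := fun t => ⟨p t, hp t⟩, source' := by simp, target' := by simp }
  let q' : Path (⟨y, hy⟩ : U) ⟨z, hz⟩ :=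
    { toFun := fun t => ⟨q t, hq t⟩, source' := by simp, target' := by simp }
  exact (SimplyConnectedSpace.paths_homotopic p' q').map ⟨Subtype.val, continuous_subtype_val⟩

/-- The unique homotopy class of paths in `U` from `y` to `z`. -/
noncomputable def IsSimplyConnected.pathClass {U : Set X} (hU : IsSimplyConnected U) {y z : X}
    (hy : y ∈ U) (hz : z ∈ U) : Path.Homotopic.Quotient y z :=
  Path.Homotopic.Quotient.mk (hU.isPathConnected.joinedIn y hy z hz).somePath

theorem IsSimplyConnected.mk_eq_pathClass {U : Set X} (hU : IsSimplyConnected U) {y z : X}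
    (p : Path y z) (hp : ∀ t, p t ∈ U) (hy : y ∈ U) (hz : z ∈ U) :
    Path.Homotopic.Quotient.mk p = hU.pathClass hy hz :=
  Path.Homotopic.Quotient.eq.2 (hU.homotopic_of_mem _ _ hp
    (hU.isPathConnected.joinedIn y hy z hz).somePath_mem)

theorem IsSimplyConnected.pathClass_trans {U : Set X} (hU : IsSimplyConnected U) {y z w : X}
    (hy : y ∈ U) (hz : z ∈ U) (hw : w ∈ U) :
    (hU.pathClass hy hz).trans (hU.pathClass hz hw) = hU.pathClass hy hw := by
  rw [← hU.mk_eq_pathClass _ _ hy hw]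
  · exact (Path.Homotopic.Quotient.mk_trans _ _).symm
  · intro t
    have := mem_range_self (f := ((hU.isPathConnected.joinedIn y hy z hz).somePath.trans
      (hU.isPathConnected.joinedIn z hz w hw).somePath)) t
    rw [Path.trans_range] at this
    rcases this with ⟨s, hs⟩ | ⟨s, hs⟩
    · exact hs ▸ JoinedIn.somePath_mem _ s
    · exact hs ▸ JoinedIn.somePath_mem _ s

variable {ι : Type*} {U : ι → Set X} (hU : ∀ i, IsSimplyConnected (U i)) {x₀ : X}

/-- A homotopy class of paths from `x₀` to the chosen point of `U i`. -/
abbrev ClassTo (x₀ : X) (i : ι) : Type _ := Path.Homotopic.Quotient x₀ (hU i).nonempty.some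

/-- The extension of a class of paths to the other points of `U i`. -/
noncomputable def ClassTo.extend {i : ι} (f : ClassTo hU x₀ i) {y : X} (hy : y ∈ U i) :
    Path.Homotopic.Quotient x₀ y :=
  f.trans ((hU i).pathClass (hU i).nonempty.some_mem hy)

theorem ClassTo.extend_trans {i : ι} (f : ClassTo hU x₀ i) {y z : X} (hy : y ∈ U i) (hz : z ∈ U i) :
    (f.extend hU hy).trans ((hU i).pathClass hy hz) = f.extend hU hz := by
  rw [extend, extend, Path.Homotopic.Quotient.trans_assoc, IsSimplyConnected.pathClass_trans]

/-- Two classes agree if their extensions agree on the intersection. -/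
def ClassTo.Agree {i j : ι} (f : ClassTo hU x₀ i) (g : ClassTo hU x₀ j) : Prop :=
  ∀ y (hi : y ∈ U i) (hj : y ∈ U j), f.extend hU hi = g.extend hU hj

namespace ClassTo

variable {hU}

theorem Agree.symm {i j : ι} {f : ClassTo hU x₀ i} {g : ClassTo hU x₀ j} (h : f.Agree hU g) :
    g.Agree hU f :=
  fun y hi hj => (h y hj hi).symm

/-- One point of agreement suffices: a path inside the intersection represents the unique path class
both in `U i` and in `U j`, so it carries agreement to any other point. -/
theorem agree_of_extend_eq {i j : ι} (hij : IsPathConnected (U i ∩ U j))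
    {f : ClassTo hU x₀ i} {g : ClassTo hU x₀ j} {y : X} (hi : y ∈ U i) (hj : y ∈ U j)
    (h : f.extend hU hi = g.extend hU hj) : f.Agree hU g := by
  intro z hzi hzj
  have hJ := hij.joinedIn y ⟨hi, hj⟩ z ⟨hzi, hzj⟩
  rw [← extend_trans hU f hi hzi, ← extend_trans hU g hj hzj, h,
    ← (hU i).mk_eq_pathClass hJ.somePath (fun t => (hJ.somePath_mem t).1),
    ← (hU j).mk_eq_pathClass hJ.somePath (fun t => (hJ.somePath_mem t).2)]

theorem exists_agree {i j : ι} (hij : IsPathConnected (U i ∩ U j)) (f : ClassTo hU x₀ i) :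
    ∃ g : ClassTo hU x₀ j, f.Agree hU g := by
  obtain ⟨y, hi, hj⟩ := hij.nonempty
  -- Follow `f` to a common point `y`, then return inside `U j` to the chosen point of `U j`.
  refine ⟨(f.extend hU hi).trans (((hU j).pathClass (hU j).nonempty.some_mem hj).symm),
    agree_of_extend_eq hij hi hj ?_⟩
  simp [extend, Path.Homotopic.Quotient.trans_assoc]

/-- A single triple point is enough, because agreement spreads over the path connected set `U i ∩ U
l`. -/
theorem Agree.trans {i j l : ι} (hil : IsPathConnected (U i ∩ U l))
    (hijl : (U i ∩ U j ∩ U l).Nonempty) {f : ClassTo hU x₀ i} {g : ClassTo hU x₀ j}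
    {h : ClassTo hU x₀ l} (hfg : f.Agree hU g) (hgh : g.Agree hU h) : f.Agree hU h := by
  obtain ⟨y, ⟨hi, hj⟩, hl⟩ := hijl
  exact agree_of_extend_eq hil hi hl ((hfg y hi hj).trans (hgh y hj hl))

end ClassTo

/-- A space that has an open cover by simply connected sets and a compatible family of homotopy
classes of paths from a basepoint to the members of the cover is simply connected. -/
theorem simplyConnectedSpace_of_agree (ho : ∀ i, IsOpen (U i)) (hc : ∀ x, ∃ i, x ∈ U i)
    (k : ∀ i, ClassTo hU x₀ i) (hk : ∀ i j, (k i).Agree hU (k j)) : SimplyConnectedSpace X := by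
  choose ix hix using hc
  let h : ∀ y, Path.Homotopic.Quotient x₀ y := fun y => (k (ix y)).extend hU (hix y)
  have hh : ∀ y i (hy : y ∈ U i), h y = (k i).extend hU hy := fun y i hy => hk _ _ _ _ _
  -- This forces the class of `p` to be the inverse of `h y` followed by `h z`, whatever `p` is. The
  -- proof subdivides `p` into pieces lying in members of the cover.
  have key : ∀ {y z : X} (p : Path y z), (h y).trans (Path.Homotopic.Quotient.mk p) = h z := by
    intro y z p
    obtain ⟨t, ht0, htm, ⟨N, htN⟩, ht⟩ := exists_monotone_Icc_subset_open_cover_unitInterval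
      (c := fun i => p ⁻¹' U i) (fun i => (ho i).preimage p.continuous)
      (fun s _ => mem_iUnion.2 ⟨ix (p s), hix (p s)⟩)
    have hQ : ∀ m,
        (h (p 0)).trans (Path.Homotopic.Quotient.mk (p.subpath 0 (t m))) = h (p (t m)) := by
      intro m
      induction m with
      | zero =>
        rw [ht0, Path.subpath_self]
        simp
      | succ m ih =>
        have h1 : Path.Homotopic.Quotient.mk (p.subpath 0 (t (m + 1))) =
            (Path.Homotopic.Quotient.mk (p.subpath 0 (t m))).trans
              (Path.Homotopic.Quotient.mk (p.subpath (t m) (t (m + 1)))) := by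
          rw [← Path.Homotopic.Quotient.mk_trans]
          exact (Path.Homotopic.Quotient.eq.2
            ⟨Path.Homotopy.subpathTransSubpath p 0 (t m) (t (m + 1))⟩).symm
        rw [h1, ← Path.Homotopic.Quotient.trans_assoc, ih]
        obtain ⟨i, hi⟩ := ht m
        have hmem : ∀ s, p.subpath (t m) (t (m + 1)) s ∈ U i := by
          intro s
          have hs := mem_range_self (f := p.subpath (t m) (t (m + 1))) s
          rw [Path.range_subpath_of_le _ _ _ (htm (Nat.le_succ m))] at hs
          obtain ⟨r, hr, hrs⟩ := hs
          exact hrs ▸ hi hr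
        have hm := hi ⟨le_rfl, htm (Nat.le_succ m)⟩
        have hm' := hi ⟨htm (Nat.le_succ m), le_rfl⟩
        rw [hh _ i hm, hh _ i hm', (hU i).mk_eq_pathClass _ hmem hm hm', ClassTo.extend_trans]
    have h2 := hQ N
    rw [htN N le_rfl, Path.subpath_zero_one] at h2
    -- The endpoints `p 0` and `p 1` equal `y` and `z` only propositionally, so the full subpath is
    -- a cast of `p`.
    have hcast : ∀ y' z' (hy : y' = y) (hz : z' = z),
        (h y').trans (Path.Homotopic.Quotient.mk (p.cast hy hz)) = h z' →
          (h y).trans (Path.Homotopic.Quotient.mk p) = h z := by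
      rintro _ _ rfl rfl h'
      exact h'
    exact hcast _ _ _ _ h2
  rw [simply_connected_iff_paths_homotopic']
  refine ⟨⟨⟨x₀⟩, fun y z => ?_⟩, fun {y z} p q => ?_⟩
  · obtain ⟨p, -⟩ := Path.Homotopic.Quotient.mk_surjective (h y)
    obtain ⟨q, -⟩ := Path.Homotopic.Quotient.mk_surjective (h z)
    exact ⟨p.symm.trans q⟩
  · rw [← Path.Homotopic.Quotient.eq]
    have h1 : (h y).trans (Path.Homotopic.Quotient.mk p) =
        (h y).trans (Path.Homotopic.Quotient.mk q) := by
      rw [key, key]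
    have h3 := congrArg (fun r => (h y).symm.trans r) h1
    simpa [← Path.Homotopic.Quotient.trans_assoc] using h3

end Cover

/-! ### Open stars in the realization of a finite complex -/

section Star

open Set Topology

universe u

variable {V : Type u} {K : PreAbstractSimplicialComplex V}

namespace Realization

/-- The barycentric coordinates. -/
def coords (x : Realization K) : V → ℝ := x.1

theorem continuous_coords : Continuous (coords (K := K)) := by
  refine continuous_iSup_dom.2 fun s => continuous_coinduced_dom.2 ?_
  exact @Continuous.mk _ _ (_) _ _ fun t ht => ⟨t, ht, rfl⟩

theorem exists_face (x : Realization K) :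
    ∃ s ∈ K.faces, (∀ v, v ∉ s → x.1 v = 0) ∧ ∑ v ∈ s, x.1 v = 1 :=
  x.2.2

/-- The normalisation is given for one face only; it passes to every finite set containing the
support by comparison with the union. -/
theorem sum_eq_one (x : Realization K) {s : Finset V} (hs : ∀ v, v ∉ s → x.1 v = 0) :
    ∑ v ∈ s, x.1 v = 1 := by
  classical
  obtain ⟨t, -, ht, h1⟩ := x.exists_face
  have h2 : ∑ v ∈ s, x.1 v = ∑ v ∈ s ∪ t, x.1 v :=
    Finset.sum_subset Finset.subset_union_left fun v _ hv => hs v hv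
  have h3 : ∑ v ∈ t, x.1 v = ∑ v ∈ s ∪ t, x.1 v :=
    Finset.sum_subset Finset.subset_union_right fun v _ hv => ht v hv
  rw [h2, ← h3, h1]

/-- A closed subset of a cube, which is compact by Tychonoff even when `V` is infinite. -/
theorem isCompact_simplex (s : Finset V) :
    IsCompact {x : V → ℝ | (∀ v, 0 ≤ x v) ∧ (∀ v, v ∉ s → x v = 0) ∧ ∑ v ∈ s, x v = 1} := by
  refine (isCompact_univ_pi fun _ : V => isCompact_Icc (a := (0 : ℝ)) (b := 1)).of_isClosed_subset
    ?_ ?_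
  · simp only [ofPred_and, ofPred_forall]
    refine (isClosed_iInter fun v => isClosed_le continuous_const (continuous_apply v)).inter
      ((isClosed_iInter fun v => isClosed_iInter fun _ =>
        isClosed_eq (continuous_apply v) continuous_const).inter
        (isClosed_eq (by fun_prop) continuous_const))
  · rintro x ⟨h0, hs, h1⟩ v -
    refine ⟨h0 v, ?_⟩
    by_cases hv : v ∈ s
    · exact h1 ▸ Finset.single_le_sum (fun w _ => h0 w) hv
    · rw [hs v hv]
      exact zero_le_one

theorem isCompact_closedSimplex {s : Finset V} (hs : s ∈ K.faces) :
    IsCompact (closedSimplex K s) := by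
  let f : closedSimplex K s → V → ℝ := fun y => y.1.1
  let τ : TopologicalSpace (closedSimplex K s) := TopologicalSpace.induced f inferInstance
  have hf : IsInducing f := ⟨rfl⟩
  have h1 : IsCompact (univ : Set (closedSimplex K s)) := by
    rw [hf.isCompact_iff]
    convert isCompact_simplex s
    ext x
    constructor
    · rintro ⟨y, -, rfl⟩
      exact ⟨y.1.2.1, y.2, y.1.sum_eq_one y.2⟩
    · rintro ⟨h0, h, h1⟩
      exact ⟨⟨⟨x, h0, s, hs, h, h1⟩, h⟩, trivial, rfl⟩
  have h2 : Continuous (Subtype.val : closedSimplex K s → Realization K) :=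
    continuous_iff_coinduced_le.2 (le_iSup (fun s : K.faces => TopologicalSpace.coinduced
      (Subtype.val : closedSimplex K s.1 → Realization K)
      (TopologicalSpace.induced (fun y v => y.1.1 v) Pi.topologicalSpace)) ⟨s, hs⟩)
  simpa using h1.image h2

/-- On a finite complex the weak topology is the topology of the barycentric coordinates. -/
theorem isEmbedding_coords (hK : K.faces.Finite) :
    IsEmbedding (coords (K := K)) := by
  have : CompactSpace (Realization K) := by
    refine ⟨?_⟩
    convert hK.isCompact_biUnion fun s hs => isCompact_closedSimplex hs
    refine (eq_univ_of_forall fun x => ?_).symm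
    obtain ⟨s, hs, h, -⟩ := x.exists_face
    exact mem_biUnion hs h
  -- A continuous injection from a compact space to a Hausdorff space is a closed embedding.
  exact (continuous_coords.isClosedEmbedding Subtype.val_injective).isEmbedding

/-- The open star of a set of vertices. -/
def star (K : PreAbstractSimplicialComplex V) (t : Finset V) : Set (Realization K) :=
  {x | ∀ v ∈ t, 0 < x.1 v}

theorem isOpen_star (t : Finset V) : IsOpen (star K t) := by
  have : star K t = ⋂ v ∈ t, {x | 0 < x.1 v} := by
    ext
    simp [star]
  rw [this]
  exact isOpen_biInter_finset fun v _ =>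
    isOpen_lt continuous_const ((continuous_apply v).comp continuous_coords)

theorem star_union [DecidableEq V] (s t : Finset V) : star K (s ∪ t) = star K s ∩ star K t := by
  ext x
  simp only [star, mem_ofPred_eq, mem_inter_iff, Finset.mem_union]
  exact ⟨fun h => ⟨fun v hv => h v (.inl hv), fun v hv => h v (.inr hv)⟩,
    fun h v hv => hv.elim (h.1 v) (h.2 v)⟩

theorem mem_faces_of_star_nonempty {t : Finset V} (ht : t.Nonempty) (h : (star K t).Nonempty) :
    t ∈ K.faces := by
  obtain ⟨x, hx⟩ := h
  obtain ⟨s, hs, h, -⟩ := x.exists_face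
  refine (K.isRelLowerSet_faces hs).2 (fun v hv => ?_) ht
  by_contra hvs
  exact (hx v hv).ne' (h v hvs)

/-- The barycenter of a face. -/
noncomputable def barycenter {t : Finset V} (ht : t ∈ K.faces) : Realization K :=
  ⟨fun v => by classical exact if v ∈ t then (t.card : ℝ)⁻¹ else 0, fun v => by
    dsimp only
    split_ifs <;> positivity, t, ht, fun v hv => if_neg hv, by
    rw [Finset.sum_congr rfl fun v hv => if_pos hv, Finset.sum_const, nsmul_eq_mul]
    have := (K.isRelLowerSet_faces ht).1.card_pos
    field_simp⟩

theorem barycenter_mem_star {t : Finset V} (ht : t ∈ K.faces) : barycenter ht ∈ star K t := by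
  intro v hv
  have := (K.isRelLowerSet_faces ht).1.card_pos
  simp only [barycenter, if_pos hv]
  positivity

/-- A point of the star has its support in a face containing `t`, so the segment to the barycenter
of `t` stays in that one simplex and keeps the coordinates on `t` positive. -/
theorem starConvex_star {t : Finset V} (ht : t ∈ K.faces) :
    StarConvex ℝ (barycenter ht).coords (coords '' star K t) := by
  rintro _ ⟨x, hx, rfl⟩ a b ha hb hab
  obtain ⟨s, hs, h, h1⟩ := exists_face x
  have hts : t ⊆ s := fun v hv => by
    by_contra hvs
    exact (hx v hv).ne' (h v hvs)
  have hbs : ∀ v, v ∉ s → (barycenter ht).1 v = 0 := fun v hv => if_neg fun hvt => hv (hts hvt)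
  refine ⟨⟨_, fun v => ?_, s, hs, fun v hv => ?_, ?_⟩, fun v hv => ?_, rfl⟩
  · have := (barycenter ht).2.1 v
    have := x.2.1 v
    simp only [coords, Pi.add_apply, Pi.smul_apply, smul_eq_mul]
    positivity
  · simp [coords, h v hv, hbs v hv]
  · simp only [coords, Pi.add_apply, Pi.smul_apply, smul_eq_mul, Finset.sum_add_distrib,
      ← Finset.mul_sum]
    rw [h1, sum_eq_one _ hbs, mul_one, mul_one, hab]
  · have h2 := barycenter_mem_star ht v hv
    have h3 := hx v hv
    simp only [coords, Pi.add_apply, Pi.smul_apply, smul_eq_mul]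
    -- For `a = 0` the barycenter contributes nothing and positivity comes from `x` alone.
    rcases ha.eq_or_lt with rfl | ha
    · rw [zero_add] at hab
      simpa [hab] using h3
    · have := mul_pos ha h2
      have := mul_nonneg hb h3.le
      linarith

theorem isSimplyConnected_star (hK : K.faces.Finite) {t : Finset V} (ht : t ∈ K.faces) :
    IsSimplyConnected (star K t) := by
  rw [← (isEmbedding_coords hK).isSimplyConnected_image]
  have := (starConvex_star ht).contractibleSpace ⟨_, mem_image_of_mem _ (barycenter_mem_star ht)⟩
  exact SimplyConnectedSpace.ofContractible _

open Classical in
/-- A finite complex is simply connected if every local system on it has global sections through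
all points of the fibre over one vertex. The vertices are indexed by `v : ι → V`, possibly with
repetitions, and the relation `R` between the fibres expresses transport along edges. -/
theorem simplyConnectedSpace_of_sections (hK : K.faces.Finite) {ι : Type*} {v : ι → V}
    (hv : ∀ i, {v i} ∈ K.faces) (hc : ∀ s ∈ K.faces, ∀ w ∈ s, ∃ i, v i = w) (i₀ : ι)
    (H : ∀ (F : ι → Type u) (R : ∀ i j, F i → F j → Prop),
      (∀ {i j f g}, R i j f g → R j i g f) →
      (∀ {i j}, {v i, v j} ∈ K.faces → ∀ f, ∃ g, R i j f g) →
      (∀ {i j l f g h}, {v i, v j, v l} ∈ K.faces → R i j f g → R j l g h → R i l f h) →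
      F i₀ → ∃ k : ∀ i, F i, ∀ i j, {v i, v j} ∈ K.faces → R i j (k i) (k j)) :
    SimplyConnectedSpace (Realization K) := by
  let U : ι → Set (Realization K) := fun i => star K {v i}
  have hU : ∀ i, IsSimplyConnected (U i) := fun i => isSimplyConnected_star hK (hv i)
  have hpair : ∀ i j, star K {v i} ∩ star K {v j} = star K {v i, v j} := fun i j =>
    (star_union _ _).symm
  have htriple : ∀ i j l, star K {v i} ∩ star K {v j} ∩ star K {v l} = star K {v i, v j, v l} :=
    fun i j l => by
      rw [hpair, ← star_union]
      congr 1
      ext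
      simp
  have hpath : ∀ {i j}, {v i, v j} ∈ K.faces →
      IsPathConnected (star K {v i} ∩ star K {v j}) := fun h => by
    rw [hpair]
    exact (isSimplyConnected_star hK h).isPathConnected
  have htrans : ∀ (i j l : ι) (f : ClassTo hU (hU i₀).nonempty.some i)
      (g : ClassTo hU (hU i₀).nonempty.some j) (h : ClassTo hU (hU i₀).nonempty.some l),
      {v i, v j, v l} ∈ K.faces → f.Agree hU g → g.Agree hU h → f.Agree hU h := by
    intro i j l f g h hF hfg hgh
    have h1 : {v i, v l} ∈ K.faces :=
      (K.isRelLowerSet_faces hF).2 (by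
        intro u hu
        simp only [Finset.mem_insert, Finset.mem_singleton] at hu ⊢
        tauto) (by simp)
    refine ClassTo.Agree.trans (U := U) (hpath h1) ?_ hfg hgh
    change (star K {v i} ∩ star K {v j} ∩ star K {v l}).Nonempty
    rw [htriple]
    exact ⟨_, barycenter_mem_star hF⟩
  -- The local system of path classes, with basepoint the chosen point of the star of `v i₀`; the
  -- constant path is the starting element of the fibre over `i₀`.
  obtain ⟨k, hk⟩ := H (ClassTo hU (hU i₀).nonempty.some) (fun i j f g => f.Agree hU g)
    (fun h => h.symm) (fun h f => ClassTo.exists_agree (U := U) (hU := hU) (hpath h) f)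
    (htrans _ _ _ _ _ _)
    (Path.Homotopic.Quotient.refl _)
  refine simplyConnectedSpace_of_agree (U := U) hU (fun i => isOpen_star _) (fun x => ?_) k
    fun i j y hi hj => ?_
  · obtain ⟨s, hs, -, h1⟩ := x.exists_face
    obtain ⟨w, hw, hw0⟩ := Finset.exists_ne_zero_of_sum_ne_zero (h1.trans_ne one_ne_zero)
    obtain ⟨i, rfl⟩ := hc s hs w hw
    refine ⟨i, fun u hu => ?_⟩
    rw [Finset.mem_singleton.1 hu]
    exact (x.2.1 _).lt_of_ne' hw0
  -- Agreement is needed only at common points, and a common point of two stars makes the two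
  -- vertices span a face.
  · exact hk i j (mem_faces_of_star_nonempty (by simp) ⟨y, hpair i j ▸ ⟨hi, hj⟩⟩) y hi hj

end Realization

end Star

/-! ### Collapses of the trees in the table -/

namespace BasedTree

variable {n : ℕ}

/-- `T'` is obtained from `T` by collapsing the edge between `e` and its parent. -/
def CollapseAt (T : BasedTree n) (e : T.Vertex) (T' : BasedTree n) : Prop :=
  ∃ f : T.Vertex → T'.Vertex,
    e ≠ T.base ∧
    (e.isRight ∨ (T.parent e).isRight) ∧
    Function.Surjective f ∧
    (∀ u v, f u = f v ↔ u = v ∨ (u = e ∧ v = T.parent e) ∨ (u = T.parent e ∧ v = e)) ∧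
    (∀ i : Fin n, f (Sum.inl i) = Sum.inl i) ∧
    f T.base = T'.base ∧
    (∀ v, v ≠ e → f (T.parent v) = T'.parent (f v))

theorem isEdgeCollapse_iff {T T' : BasedTree n} :
    IsEdgeCollapse T T' ↔ ∃ e, CollapseAt T e T' :=
  Iff.rfl

/-- Two trees are isomorphic if there is an isomorphism that preserves names and basepoints. -/
def Isomorphic (T T' : BasedTree n) : Prop :=
  ∃ f : T.Vertex ≃ T'.Vertex, IsIso T T' f

theorem Isomorphic.refl (T : BasedTree n) : Isomorphic T T :=
  ⟨Equiv.refl _, fun _ => rfl, rfl, fun _ => rfl⟩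

theorem Isomorphic.symm {T T' : BasedTree n} (h : Isomorphic T T') : Isomorphic T' T := by
  obtain ⟨f, h1, h2, h3⟩ := h
  refine ⟨f.symm, fun i => ?_, ?_, fun v => ?_⟩
  · rw [Equiv.symm_apply_eq, h1]
  · rw [Equiv.symm_apply_eq, h2]
  · rw [Equiv.symm_apply_eq, h3, Equiv.apply_symm_apply]

theorem Isomorphic.trans {T T' T'' : BasedTree n} (h : Isomorphic T T')
    (h' : Isomorphic T' T'') : Isomorphic T T'' := by
  obtain ⟨f, h1, h2, h3⟩ := h
  obtain ⟨f', h1', h2', h3'⟩ := h'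
  refine ⟨f.trans f', fun i => ?_, ?_, fun v => ?_⟩
  · simp [h1, h1']
  · simp [h2, h2']
  · simp [h3, h3']

/-- Both collapsing maps are surjective with the same fibres, determined by `T` and `e`; hence one
factors through the other by a bijection. -/
theorem CollapseAt.unique {T T' T'' : BasedTree n} {e : T.Vertex} (h : CollapseAt T e T')
    (h' : CollapseAt T e T'') : Isomorphic T' T'' := by
  obtain ⟨f, he, -, hs, hf, hn, hb, hp⟩ := h
  obtain ⟨f', -, -, hs', hf', hn', hb', hp'⟩ := h'
  have key : ∀ u, f' (Function.surjInv hs (f u)) = f' u := fun u => by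
    rw [hf', ← hf]
    exact Function.surjInv_eq hs _
  have hbij : Function.Bijective fun w => f' (Function.surjInv hs w) := by
    constructor
    · intro w w' h
      obtain ⟨u, rfl⟩ := hs w
      obtain ⟨u', rfl⟩ := hs w'
      simp only [key] at h
      rwa [hf, ← hf']
    · intro w
      obtain ⟨u, rfl⟩ := hs' w
      exact ⟨f u, key u⟩
  refine ⟨Equiv.ofBijective _ hbij, fun i => ?_, ?_, fun w => ?_⟩
  · rw [← hn i]
    exact (key _).trans (hn' i)
  · rw [← hb]
    exact (key _).trans hb'
  -- Parents are controlled only away from `e`, but `e` has the same image as its parent, which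
  -- differs from `e` because a fixed point of `parent` would have to be the basepoint.
  · have hw : ∃ v, v ≠ e ∧ f v = w := by
      obtain ⟨v, rfl⟩ := hs w
      by_cases hv : v = e
      · subst hv
        refine ⟨T.parent v, fun hpe => he ?_, (hf _ _).2 (by simp)⟩
        obtain ⟨m, hm⟩ := T.reaches_base v
        rwa [Function.iterate_fixed hpe] at hm
      · exact ⟨v, hv, rfl⟩
    obtain ⟨v, hv, rfl⟩ := hw
    simp only [Equiv.ofBijective_apply]
    rw [← hp v hv, key, key, hp' v hv]

theorem CollapseAt.of_isIso {T₁ T₂ T' : BasedTree n} {g : T₁.Vertex ≃ T₂.Vertex}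
    (hg : IsIso T₁ T₂ g) {e : T₁.Vertex} (h : CollapseAt T₁ e T') : CollapseAt T₂ (g e) T' := by
  obtain ⟨f, h1, h2, h3, h4, h5, h6, h7⟩ := h
  obtain ⟨g1, g2, g3⟩ := hg
  -- Names are fixed and `g` is injective, so no trivial vertex can be sent to a named one.
  have hr : ∀ v, (g v).isRight = v.isRight := by
    rintro (i | t)
    · rw [g1, Sum.isRight_inl, Sum.isRight_inl]
    · rcases hw : g (Sum.inr t) with i | t'
      · rw [← g1, g.apply_eq_iff_eq] at hw
        cases hw
      · rfl
  have gs : ∀ w, g.symm (T₂.parent w) = T₁.parent (g.symm w) := fun w => by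
    rw [Equiv.symm_apply_eq, g3, Equiv.apply_symm_apply]
  refine ⟨f ∘ g.symm, ?_, ?_, h3.comp g.symm.surjective, fun u v => ?_, fun i => ?_, ?_,
    fun v hv => ?_⟩
  · rwa [← g2, Ne, g.apply_eq_iff_eq]
  · rwa [← g3, hr, hr]
  · simp only [Function.comp_apply, h4, ← g3, g.symm_apply_eq, g.apply_symm_apply]
  · rw [Function.comp_apply, g.symm_apply_eq.2 (g1 i).symm, h5]
  · rw [Function.comp_apply, ← g2, g.symm_apply_apply, h6]
  · rw [Function.comp_apply, Function.comp_apply, gs, h7]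
    rwa [Ne, g.symm_apply_eq]

/-- The choice of some of the indices. -/
def sel {k m : ℕ} (e : Fin m ↪ Fin n) (s : Fin k → Fin m)
    (hs : Function.Injective s := by decide) : Fin k ↪ Fin n :=
  ⟨fun i => e (s i), fun _ _ h => hs (e.injective h)⟩

theorem sel_apply {k m : ℕ} (e : Fin m ↪ Fin n) (s : Fin k → Fin m) (hs : Function.Injective s)
    (i : Fin k) : sel e s hs i = e (s i) :=
  rfl

end BasedTree

/-- The names of the trees in the table. -/
inductive Code (n : ℕ)
  | alpha : Code n
  | A (e : Fin 1 ↪ Fin n) : Code n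
  | rho (e : Fin 2 ↪ Fin n) : Code n
  | beta (e : Fin 2 ↪ Fin n) : Code n
  | gamma (e : Fin 3 ↪ Fin n) : Code n
  | B (e : Fin 3 ↪ Fin n) : Code n
  | sigma (e : Fin 5 ↪ Fin n) : Code n
  | tau (e : Fin 4 ↪ Fin n) : Code n
  | delta (e : Fin 5 ↪ Fin n) : Code n
  | epsilon (e : Fin 4 ↪ Fin n) : Code n
  | C (e : Fin 5 ↪ Fin n) : Code n

namespace Code

open BasedTree

variable {n : ℕ}

/-- The tree with the given name. -/
def tree : Code n → BasedTree n
  | alpha => BasedTree.alpha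
  | A e => BasedTree.A e
  | rho e => BasedTree.rho e
  | beta e => BasedTree.beta e
  | gamma e => BasedTree.gamma e
  | B e => BasedTree.B e
  | sigma e => BasedTree.sigma e
  | tau e => BasedTree.tau e
  | delta e => BasedTree.delta e
  | epsilon e => BasedTree.epsilon e
  | C e => BasedTree.C e

theorem inTable_tree (c : Code n) : c.tree.InTable := by
  cases c <;> constructor

theorem exists_tree_eq {T : BasedTree n} (hT : T.InTable) : ∃ c : Code n, c.tree = T := by
  cases hT
  exacts [⟨alpha, rfl⟩, ⟨A _, rfl⟩, ⟨rho _, rfl⟩, ⟨beta _, rfl⟩, ⟨gamma _, rfl⟩, ⟨B _, rfl⟩,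
    ⟨sigma _, rfl⟩, ⟨tau _, rfl⟩, ⟨delta _, rfl⟩, ⟨epsilon _, rfl⟩, ⟨C _, rfl⟩]

instance : Finite (Code n) := by
  refine Finite.of_surjective (α := Unit ⊕ (Fin 1 ↪ Fin n) ⊕ (Bool × (Fin 2 ↪ Fin n)) ⊕
    (Bool × (Fin 3 ↪ Fin n)) ⊕ (Bool × (Fin 4 ↪ Fin n)) ⊕ (Fin 3 × (Fin 5 ↪ Fin n)))
    (fun x => match x with
      | .inl _ => alpha
      | .inr (.inl e) => A e
      | .inr (.inr (.inl (b, e))) => bif b then rho e else beta e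
      | .inr (.inr (.inr (.inl (b, e)))) => bif b then gamma e else B e
      | .inr (.inr (.inr (.inr (.inl (b, e))))) => bif b then tau e else epsilon e
      | .inr (.inr (.inr (.inr (.inr (b, e))))) => ![sigma e, delta e, C e] b) ?_
  rintro (_ | e | e | e | e | e | e | e | e | e | e)
  · exact ⟨.inl (), rfl⟩
  · exact ⟨.inr (.inl e), rfl⟩
  · exact ⟨.inr (.inr (.inl (true, e))), rfl⟩
  · exact ⟨.inr (.inr (.inl (false, e))), rfl⟩
  · exact ⟨.inr (.inr (.inr (.inl (true, e)))), rfl⟩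
  · exact ⟨.inr (.inr (.inr (.inl (false, e)))), rfl⟩
  · exact ⟨.inr (.inr (.inr (.inr (.inr (0, e))))), rfl⟩
  · exact ⟨.inr (.inr (.inr (.inr (.inl (true, e))))), rfl⟩
  · exact ⟨.inr (.inr (.inr (.inr (.inr (1, e))))), rfl⟩
  · exact ⟨.inr (.inr (.inr (.inr (.inl (false, e))))), rfl⟩
  · exact ⟨.inr (.inr (.inr (.inr (.inr (2, e))))), rfl⟩

end Code

/-! ### The collapses of single edges between trees of the table. -/

namespace Code

open BasedTree

variable {n : ℕ}

theorem ne2 (e : Fin 2 ↪ Fin n) : e 0 ≠ e 1 := by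
  simp

theorem ne3 (e : Fin 3 ↪ Fin n) : e 0 ≠ e 1 ∧ e 0 ≠ e 2 ∧ e 1 ≠ e 2 := by
  simp

theorem ne4 (e : Fin 4 ↪ Fin n) :
    e 0 ≠ e 1 ∧ e 0 ≠ e 2 ∧ e 0 ≠ e 3 ∧ e 1 ≠ e 2 ∧ e 1 ≠ e 3 ∧ e 2 ≠ e 3 := by
  simp

theorem ne5 (e : Fin 5 ↪ Fin n) :
    e 0 ≠ e 1 ∧ e 0 ≠ e 2 ∧ e 0 ≠ e 3 ∧ e 0 ≠ e 4 ∧ e 1 ≠ e 2 ∧ e 1 ≠ e 3 ∧ e 1 ≠ e 4 ∧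
      e 2 ≠ e 3 ∧ e 2 ≠ e 4 ∧ e 3 ≠ e 4 := by
  simp

/-- The collapses of a single edge: `StepAt c v c'` means that the tree `c` becomes the tree `c'`
when the edge above `v` is collapsed. -/
inductive StepAt : (c : Code n) → c.tree.Vertex → Code n → Prop
  | alpha_A (e : Fin 1 ↪ Fin n) : StepAt alpha (Sum.inl (e 0)) (A e)
  | rho_alpha (e : Fin 2 ↪ Fin n) : StepAt (rho e) (Sum.inr (1 : Fin 2)) alpha
  | rho_beta (e : Fin 2 ↪ Fin n) : StepAt (rho e) (Sum.inl (e 0)) (beta e)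
  | rho_beta' (e : Fin 2 ↪ Fin n) : StepAt (rho e) (Sum.inl (e 1)) (beta (sel e ![1, 0]))
  | rho_gamma (e : Fin 3 ↪ Fin n) : StepAt (rho (sel e ![1, 2])) (Sum.inl (e 0)) (gamma e)
  | beta_A (e : Fin 2 ↪ Fin n) : StepAt (beta e) (Sum.inl (e 0)) (A (sel e ![0]))
  | beta_B (e : Fin 3 ↪ Fin n) : StepAt (beta (sel e ![1, 2])) (Sum.inl (e 0)) (B e)
  | gamma_A (e : Fin 3 ↪ Fin n) : StepAt (gamma e) (Sum.inr (0 : Fin 1)) (A (sel e ![0]))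
  | gamma_B (e : Fin 3 ↪ Fin n) : StepAt (gamma e) (Sum.inl (e 1)) (B e)
  | gamma_B' (e : Fin 3 ↪ Fin n) : StepAt (gamma e) (Sum.inl (e 2)) (B (sel e ![0, 2, 1]))
  | sigma_gamma (e : Fin 5 ↪ Fin n) :
      StepAt (sigma e) (Sum.inr (1 : Fin 2)) (gamma (sel e ![0, 1, 2]))
  | sigma_gamma' (e : Fin 5 ↪ Fin n) :
      StepAt (sigma e) (Sum.inr (0 : Fin 2)) (gamma (sel e ![0, 3, 4]))
  | sigma_delta (e : Fin 5 ↪ Fin n) : StepAt (sigma e) (Sum.inl (e 1)) (delta e)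
  | sigma_delta₂ (e : Fin 5 ↪ Fin n) :
      StepAt (sigma e) (Sum.inl (e 2)) (delta (sel e ![0, 2, 1, 3, 4]))
  | sigma_delta₃ (e : Fin 5 ↪ Fin n) :
      StepAt (sigma e) (Sum.inl (e 3)) (delta (sel e ![0, 3, 4, 1, 2]))
  | sigma_delta₄ (e : Fin 5 ↪ Fin n) :
      StepAt (sigma e) (Sum.inl (e 4)) (delta (sel e ![0, 4, 3, 1, 2]))
  | tau_gamma (e : Fin 4 ↪ Fin n) : StepAt (tau e) (Sum.inl (e 0)) (gamma (sel e ![0, 2, 3]))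
  | tau_beta (e : Fin 4 ↪ Fin n) : StepAt (tau e) (Sum.inr (1 : Fin 2)) (beta (sel e ![0, 1]))
  | tau_epsilon (e : Fin 4 ↪ Fin n) : StepAt (tau e) (Sum.inl (e 2)) (epsilon e)
  | tau_epsilon' (e : Fin 4 ↪ Fin n) :
      StepAt (tau e) (Sum.inl (e 3)) (epsilon (sel e ![0, 1, 3, 2]))
  | tau_delta (e : Fin 5 ↪ Fin n) :
      StepAt (tau (sel e ![1, 2, 3, 4])) (Sum.inl (e 0)) (delta e)
  | delta_B (e : Fin 5 ↪ Fin n) : StepAt (delta e) (Sum.inr (0 : Fin 1)) (B (sel e ![0, 1, 2]))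
  | delta_C (e : Fin 5 ↪ Fin n) : StepAt (delta e) (Sum.inl (e 3)) (C e)
  | delta_C' (e : Fin 5 ↪ Fin n) :
      StepAt (delta e) (Sum.inl (e 4)) (C (sel e ![0, 1, 2, 4, 3]))
  | epsilon_B (e : Fin 4 ↪ Fin n) :
      StepAt (epsilon e) (Sum.inl (e 0)) (B (sel e ![0, 2, 3]))
  | epsilon_B' (e : Fin 4 ↪ Fin n) :
      StepAt (epsilon e) (Sum.inl (e 2)) (B (sel e ![2, 0, 1]))
  | epsilon_C (e : Fin 5 ↪ Fin n) :
      StepAt (epsilon (sel e ![1, 2, 3, 4])) (Sum.inl (e 0)) (C e)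

set_option linter.unusedSimpArgs false
set_option linter.unnecessarySeqFocus false

/-- Here and below the collapsing map fixes all names, so only the images of the trivial vertices
have to be given: the one at the collapsed edge goes to the merged vertex, and another one, if
present, to the surviving trivial vertex. The conditions are then a finite case check using that the
indices are distinct. -/
theorem collapseAt_alpha_A (e : Fin 1 ↪ Fin n) :
    CollapseAt alpha.tree (Sum.inl (e 0)) (A e).tree := by
  refine ⟨Sum.elim Sum.inl (fun _ : Fin 1 => Sum.inl (e 0)),
    ?_, ?_, ?_, ?_, ?_, ?_, ?_⟩ <;>
    simp [tree, BasedTree.alpha, BasedTree.A, ofDepthTwo, sel_apply,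
      Fin.forall_fin_two, Function.Surjective] <;>
    grind

theorem collapseAt_rho_alpha (e : Fin 2 ↪ Fin n) :
    CollapseAt (rho e).tree (Sum.inr (1 : Fin 2)) alpha.tree := by
  have := ne2 e
  refine ⟨Sum.elim Sum.inl (fun t : Fin 2 =>
      if t = 0 then Sum.inr (0 : Fin 1) else Sum.inr (0 : Fin 1)),
    ?_, ?_, ?_, ?_, ?_, ?_, ?_⟩ <;>
    simp [tree, BasedTree.rho, BasedTree.alpha, ofDepthTwo, sel_apply,
      Fin.forall_fin_two, Function.Surjective] <;>
    grind

theorem collapseAt_rho_beta (e : Fin 2 ↪ Fin n) :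
    CollapseAt (rho e).tree (Sum.inl (e 0)) (beta e).tree := by
  have := ne2 e
  refine ⟨Sum.elim Sum.inl (fun t : Fin 2 =>
      if t = 0 then Sum.inr (0 : Fin 1) else Sum.inl (e 0)),
    ?_, ?_, ?_, ?_, ?_, ?_, ?_⟩ <;>
    simp [tree, BasedTree.rho, BasedTree.beta, ofDepthTwo, sel_apply,
      Fin.forall_fin_two, Function.Surjective] <;>
    grind

theorem collapseAt_rho_beta' (e : Fin 2 ↪ Fin n) :
    CollapseAt (rho e).tree (Sum.inl (e 1)) (beta (sel e ![1, 0])).tree := by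
  have := ne2 e
  refine ⟨Sum.elim Sum.inl (fun t : Fin 2 =>
      if t = 0 then Sum.inr (0 : Fin 1) else Sum.inl (e 1)),
    ?_, ?_, ?_, ?_, ?_, ?_, ?_⟩ <;>
    simp [tree, BasedTree.rho, BasedTree.beta, ofDepthTwo, sel_apply,
      Fin.forall_fin_two, Function.Surjective] <;>
    grind

theorem collapseAt_rho_gamma (e : Fin 3 ↪ Fin n) :
    CollapseAt (rho (sel e ![1, 2])).tree (Sum.inl (e 0)) (gamma e).tree := by
  have := ne3 e
  refine ⟨Sum.elim Sum.inl (fun t : Fin 2 =>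
      if t = 0 then Sum.inl (e 0) else Sum.inr (0 : Fin 1)),
    ?_, ?_, ?_, ?_, ?_, ?_, ?_⟩ <;>
    simp [tree, BasedTree.rho, BasedTree.gamma, ofDepthTwo, sel_apply,
      Fin.forall_fin_two, Function.Surjective] <;>
    grind

theorem collapseAt_beta_A (e : Fin 2 ↪ Fin n) :
    CollapseAt (beta e).tree (Sum.inl (e 0)) (A (sel e ![0])).tree := by
  have := ne2 e
  refine ⟨Sum.elim Sum.inl (fun _ : Fin 1 => Sum.inl (e 0)),
    ?_, ?_, ?_, ?_, ?_, ?_, ?_⟩ <;>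
    simp [tree, BasedTree.beta, BasedTree.A, ofDepthTwo, sel_apply,
      Fin.forall_fin_two, Function.Surjective] <;>
    grind

theorem collapseAt_beta_B (e : Fin 3 ↪ Fin n) :
    CollapseAt (beta (sel e ![1, 2])).tree (Sum.inl (e 0)) (B e).tree := by
  have := ne3 e
  refine ⟨Sum.elim Sum.inl (fun _ : Fin 1 => Sum.inl (e 0)),
    ?_, ?_, ?_, ?_, ?_, ?_, ?_⟩ <;>
    simp [tree, BasedTree.beta, BasedTree.B, ofDepthTwo, sel_apply,
      Fin.forall_fin_two, Function.Surjective] <;>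
    grind

theorem collapseAt_gamma_A (e : Fin 3 ↪ Fin n) :
    CollapseAt (gamma e).tree (Sum.inr (0 : Fin 1)) (A (sel e ![0])).tree := by
  have := ne3 e
  refine ⟨Sum.elim Sum.inl (fun _ : Fin 1 => Sum.inl (e 0)),
    ?_, ?_, ?_, ?_, ?_, ?_, ?_⟩ <;>
    simp [tree, BasedTree.gamma, BasedTree.A, ofDepthTwo, sel_apply,
      Fin.forall_fin_two, Function.Surjective] <;>
    grind

theorem collapseAt_gamma_B (e : Fin 3 ↪ Fin n) :
    CollapseAt (gamma e).tree (Sum.inl (e 1)) (B e).tree := by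
  have := ne3 e
  refine ⟨Sum.elim Sum.inl (fun _ : Fin 1 => Sum.inl (e 1)),
    ?_, ?_, ?_, ?_, ?_, ?_, ?_⟩ <;>
    simp [tree, BasedTree.gamma, BasedTree.B, ofDepthTwo, sel_apply,
      Fin.forall_fin_two, Function.Surjective] <;>
    grind

theorem collapseAt_gamma_B' (e : Fin 3 ↪ Fin n) :
    CollapseAt (gamma e).tree (Sum.inl (e 2)) (B (sel e ![0, 2, 1])).tree := by
  have := ne3 e
  refine ⟨Sum.elim Sum.inl (fun _ : Fin 1 => Sum.inl (e 2)),
    ?_, ?_, ?_, ?_, ?_, ?_, ?_⟩ <;>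
    simp [tree, BasedTree.gamma, BasedTree.B, ofDepthTwo, sel_apply,
      Fin.forall_fin_two, Function.Surjective] <;>
    grind

theorem collapseAt_sigma_gamma (e : Fin 5 ↪ Fin n) :
    CollapseAt (sigma e).tree (Sum.inr (1 : Fin 2)) (gamma (sel e ![0, 1, 2])).tree := by
  have := ne5 e
  refine ⟨Sum.elim Sum.inl (fun t : Fin 2 =>
      if t = 0 then Sum.inr (0 : Fin 1) else Sum.inl (e 0)),
    ?_, ?_, ?_, ?_, ?_, ?_, ?_⟩ <;>
    simp [tree, BasedTree.sigma, BasedTree.gamma, ofDepthTwo, sel_apply,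
      Fin.forall_fin_two, Function.Surjective] <;>
    grind

theorem collapseAt_sigma_gamma' (e : Fin 5 ↪ Fin n) :
    CollapseAt (sigma e).tree (Sum.inr (0 : Fin 2)) (gamma (sel e ![0, 3, 4])).tree := by
  have := ne5 e
  refine ⟨Sum.elim Sum.inl (fun t : Fin 2 =>
      if t = 0 then Sum.inl (e 0) else Sum.inr (0 : Fin 1)),
    ?_, ?_, ?_, ?_, ?_, ?_, ?_⟩ <;>
    simp [tree, BasedTree.sigma, BasedTree.gamma, ofDepthTwo, sel_apply,
      Fin.forall_fin_two, Function.Surjective] <;>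
    grind

theorem collapseAt_sigma_delta (e : Fin 5 ↪ Fin n) :
    CollapseAt (sigma e).tree (Sum.inl (e 1)) (delta e).tree := by
  have := ne5 e
  refine ⟨Sum.elim Sum.inl (fun t : Fin 2 =>
      if t = 0 then Sum.inl (e 1) else Sum.inr (0 : Fin 1)),
    ?_, ?_, ?_, ?_, ?_, ?_, ?_⟩ <;>
    simp [tree, BasedTree.sigma, BasedTree.delta, ofDepthTwo, sel_apply,
      Fin.forall_fin_two, Function.Surjective] <;>
    grind

theorem collapseAt_sigma_delta₂ (e : Fin 5 ↪ Fin n) :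
    CollapseAt (sigma e).tree (Sum.inl (e 2)) (delta (sel e ![0, 2, 1, 3, 4])).tree := by
  have := ne5 e
  refine ⟨Sum.elim Sum.inl (fun t : Fin 2 =>
      if t = 0 then Sum.inl (e 2) else Sum.inr (0 : Fin 1)),
    ?_, ?_, ?_, ?_, ?_, ?_, ?_⟩ <;>
    simp [tree, BasedTree.sigma, BasedTree.delta, ofDepthTwo, sel_apply,
      Fin.forall_fin_two, Function.Surjective] <;>
    grind

theorem collapseAt_sigma_delta₃ (e : Fin 5 ↪ Fin n) :
    CollapseAt (sigma e).tree (Sum.inl (e 3)) (delta (sel e ![0, 3, 4, 1, 2])).tree := by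
  have := ne5 e
  refine ⟨Sum.elim Sum.inl (fun t : Fin 2 =>
      if t = 0 then Sum.inr (0 : Fin 1) else Sum.inl (e 3)),
    ?_, ?_, ?_, ?_, ?_, ?_, ?_⟩ <;>
    simp [tree, BasedTree.sigma, BasedTree.delta, ofDepthTwo, sel_apply,
      Fin.forall_fin_two, Function.Surjective] <;>
    grind

theorem collapseAt_sigma_delta₄ (e : Fin 5 ↪ Fin n) :
    CollapseAt (sigma e).tree (Sum.inl (e 4)) (delta (sel e ![0, 4, 3, 1, 2])).tree := by
  have := ne5 e
  refine ⟨Sum.elim Sum.inl (fun t : Fin 2 =>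
      if t = 0 then Sum.inr (0 : Fin 1) else Sum.inl (e 4)),
    ?_, ?_, ?_, ?_, ?_, ?_, ?_⟩ <;>
    simp [tree, BasedTree.sigma, BasedTree.delta, ofDepthTwo, sel_apply,
      Fin.forall_fin_two, Function.Surjective] <;>
    grind

theorem collapseAt_tau_gamma (e : Fin 4 ↪ Fin n) :
    CollapseAt (tau e).tree (Sum.inl (e 0)) (gamma (sel e ![0, 2, 3])).tree := by
  have := ne4 e
  refine ⟨Sum.elim Sum.inl (fun t : Fin 2 =>
      if t = 0 then Sum.inl (e 0) else Sum.inr (0 : Fin 1)),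
    ?_, ?_, ?_, ?_, ?_, ?_, ?_⟩ <;>
    simp [tree, BasedTree.tau, BasedTree.gamma, ofDepthTwo, sel_apply,
      Fin.forall_fin_two, Function.Surjective] <;>
    grind

theorem collapseAt_tau_beta (e : Fin 4 ↪ Fin n) :
    CollapseAt (tau e).tree (Sum.inr (1 : Fin 2)) (beta (sel e ![0, 1])).tree := by
  have := ne4 e
  refine ⟨Sum.elim Sum.inl (fun t : Fin 2 =>
      if t = 0 then Sum.inr (0 : Fin 1) else Sum.inr (0 : Fin 1)),
    ?_, ?_, ?_, ?_, ?_, ?_, ?_⟩ <;>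
    simp [tree, BasedTree.tau, BasedTree.beta, ofDepthTwo, sel_apply,
      Fin.forall_fin_two, Function.Surjective] <;>
    grind

theorem collapseAt_tau_epsilon (e : Fin 4 ↪ Fin n) :
    CollapseAt (tau e).tree (Sum.inl (e 2)) (epsilon e).tree := by
  have := ne4 e
  refine ⟨Sum.elim Sum.inl (fun t : Fin 2 =>
      if t = 0 then Sum.inr (0 : Fin 1) else Sum.inl (e 2)),
    ?_, ?_, ?_, ?_, ?_, ?_, ?_⟩ <;>
    simp [tree, BasedTree.tau, BasedTree.epsilon, ofDepthTwo, sel_apply,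
      Fin.forall_fin_two, Function.Surjective] <;>
    grind

theorem collapseAt_tau_epsilon' (e : Fin 4 ↪ Fin n) :
    CollapseAt (tau e).tree (Sum.inl (e 3)) (epsilon (sel e ![0, 1, 3, 2])).tree := by
  have := ne4 e
  refine ⟨Sum.elim Sum.inl (fun t : Fin 2 =>
      if t = 0 then Sum.inr (0 : Fin 1) else Sum.inl (e 3)),
    ?_, ?_, ?_, ?_, ?_, ?_, ?_⟩ <;>
    simp [tree, BasedTree.tau, BasedTree.epsilon, ofDepthTwo, sel_apply,
      Fin.forall_fin_two, Function.Surjective] <;>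
    grind

theorem collapseAt_tau_delta (e : Fin 5 ↪ Fin n) :
    CollapseAt (tau (sel e ![1, 2, 3, 4])).tree (Sum.inl (e 0)) (delta e).tree := by
  have := ne5 e
  refine ⟨Sum.elim Sum.inl (fun t : Fin 2 =>
      if t = 0 then Sum.inl (e 0) else Sum.inr (0 : Fin 1)),
    ?_, ?_, ?_, ?_, ?_, ?_, ?_⟩ <;>
    simp [tree, BasedTree.tau, BasedTree.delta, ofDepthTwo, sel_apply,
      Fin.forall_fin_two, Function.Surjective] <;>
    grind

theorem collapseAt_delta_B (e : Fin 5 ↪ Fin n) :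
    CollapseAt (delta e).tree (Sum.inr (0 : Fin 1)) (B (sel e ![0, 1, 2])).tree := by
  have := ne5 e
  refine ⟨Sum.elim Sum.inl (fun _ : Fin 1 => Sum.inl (e 0)),
    ?_, ?_, ?_, ?_, ?_, ?_, ?_⟩ <;>
    simp [tree, BasedTree.delta, BasedTree.B, ofDepthTwo, sel_apply,
      Fin.forall_fin_two, Function.Surjective] <;>
    grind

theorem collapseAt_delta_C (e : Fin 5 ↪ Fin n) :
    CollapseAt (delta e).tree (Sum.inl (e 3)) (C e).tree := by
  have := ne5 e
  refine ⟨Sum.elim Sum.inl (fun _ : Fin 1 => Sum.inl (e 3)),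
    ?_, ?_, ?_, ?_, ?_, ?_, ?_⟩ <;>
    simp [tree, BasedTree.delta, BasedTree.C, ofDepthTwo, sel_apply,
      Fin.forall_fin_two, Function.Surjective] <;>
    grind

theorem collapseAt_delta_C' (e : Fin 5 ↪ Fin n) :
    CollapseAt (delta e).tree (Sum.inl (e 4)) (C (sel e ![0, 1, 2, 4, 3])).tree := by
  have := ne5 e
  refine ⟨Sum.elim Sum.inl (fun _ : Fin 1 => Sum.inl (e 4)),
    ?_, ?_, ?_, ?_, ?_, ?_, ?_⟩ <;>
    simp [tree, BasedTree.delta, BasedTree.C, ofDepthTwo, sel_apply,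
      Fin.forall_fin_two, Function.Surjective] <;>
    grind

theorem collapseAt_epsilon_B (e : Fin 4 ↪ Fin n) :
    CollapseAt (epsilon e).tree (Sum.inl (e 0)) (B (sel e ![0, 2, 3])).tree := by
  have := ne4 e
  refine ⟨Sum.elim Sum.inl (fun _ : Fin 1 => Sum.inl (e 0)),
    ?_, ?_, ?_, ?_, ?_, ?_, ?_⟩ <;>
    simp [tree, BasedTree.epsilon, BasedTree.B, ofDepthTwo, sel_apply,
      Fin.forall_fin_two, Function.Surjective] <;>
    grind

theorem collapseAt_epsilon_B' (e : Fin 4 ↪ Fin n) :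
    CollapseAt (epsilon e).tree (Sum.inl (e 2)) (B (sel e ![2, 0, 1])).tree := by
  have := ne4 e
  refine ⟨Sum.elim Sum.inl (fun _ : Fin 1 => Sum.inl (e 2)),
    ?_, ?_, ?_, ?_, ?_, ?_, ?_⟩ <;>
    simp [tree, BasedTree.epsilon, BasedTree.B, ofDepthTwo, sel_apply,
      Fin.forall_fin_two, Function.Surjective] <;>
    grind

theorem collapseAt_epsilon_C (e : Fin 5 ↪ Fin n) :
    CollapseAt (epsilon (sel e ![1, 2, 3, 4])).tree (Sum.inl (e 0)) (C e).tree := by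
  have := ne5 e
  refine ⟨Sum.elim Sum.inl (fun _ : Fin 1 => Sum.inl (e 0)),
    ?_, ?_, ?_, ?_, ?_, ?_, ?_⟩ <;>
    simp [tree, BasedTree.epsilon, BasedTree.C, ofDepthTwo, sel_apply,
      Fin.forall_fin_two, Function.Surjective] <;>
    grind

theorem StepAt.collapseAt {c c' : Code n} {v : c.tree.Vertex} (h : StepAt c v c') :
    CollapseAt c.tree v c'.tree := by
  cases h with
  | alpha_A e => exact collapseAt_alpha_A e
  | rho_alpha e => exact collapseAt_rho_alpha e
  | rho_beta e => exact collapseAt_rho_beta e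
  | rho_beta' e => exact collapseAt_rho_beta' e
  | rho_gamma e => exact collapseAt_rho_gamma e
  | beta_A e => exact collapseAt_beta_A e
  | beta_B e => exact collapseAt_beta_B e
  | gamma_A e => exact collapseAt_gamma_A e
  | gamma_B e => exact collapseAt_gamma_B e
  | gamma_B' e => exact collapseAt_gamma_B' e
  | sigma_gamma e => exact collapseAt_sigma_gamma e
  | sigma_gamma' e => exact collapseAt_sigma_gamma' e
  | sigma_delta e => exact collapseAt_sigma_delta e
  | sigma_delta₂ e => exact collapseAt_sigma_delta₂ e
  | sigma_delta₃ e => exact collapseAt_sigma_delta₃ e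
  | sigma_delta₄ e => exact collapseAt_sigma_delta₄ e
  | tau_gamma e => exact collapseAt_tau_gamma e
  | tau_beta e => exact collapseAt_tau_beta e
  | tau_epsilon e => exact collapseAt_tau_epsilon e
  | tau_epsilon' e => exact collapseAt_tau_epsilon' e
  | tau_delta e => exact collapseAt_tau_delta e
  | delta_B e => exact collapseAt_delta_B e
  | delta_C e => exact collapseAt_delta_C e
  | delta_C' e => exact collapseAt_delta_C' e
  | epsilon_B e => exact collapseAt_epsilon_B e
  | epsilon_B' e => exact collapseAt_epsilon_B' e
  | epsilon_C e => exact collapseAt_epsilon_C e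

end Code

/-! ### Closure of the table under collapses, and isomorphism invariants of its trees. -/

namespace BasedTree

variable {n : ℕ}

/-- Collapsing the edge to an unmentioned leaf `i` makes `i` the basepoint, so the code of the
result has `i` prepended. The map `s` is kept as a variable so that literals such as `![1, 2]` match
the constructors of `StepAt`. -/
theorem exists_cons {m : ℕ} (e : Fin m ↪ Fin n) {i : Fin n} (hi : ∀ x, i ≠ e x)
    (s : Fin m → Fin (m + 1)) (hs : Function.Injective s) (hs' : s = Fin.succ) :
    ∃ e' : Fin (m + 1) ↪ Fin n, i = e' 0 ∧ e = sel e' s hs := by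
  subst hs'
  refine ⟨⟨Fin.cons i e, Fin.cons_injective_iff.2 ⟨?_, e.injective⟩⟩, rfl, ?_⟩
  · rintro ⟨x, hx⟩
    exact hi x hx.symm
  · ext x
    rfl

theorem Isomorphic.base_eq_iff {T T' : BasedTree n} (h : Isomorphic T T') (i : Fin n) :
    T.base = Sum.inl i ↔ T'.base = Sum.inl i := by
  obtain ⟨f, h1, h2, h3⟩ := h
  rw [← h2, ← h1, f.apply_eq_iff_eq]

theorem Isomorphic.parent_eq_base_iff {T T' : BasedTree n} (h : Isomorphic T T') (i : Fin n) :
    T.parent (Sum.inl i) = T.base ↔ T'.parent (Sum.inl i) = T'.base := by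
  obtain ⟨f, h1, h2, h3⟩ := h
  rw [← h2, ← h1, ← h3, f.apply_eq_iff_eq]

theorem Isomorphic.parent_eq_iff {T T' : BasedTree n} (h : Isomorphic T T') (i j : Fin n) :
    T.parent (Sum.inl i) = Sum.inl j ↔ T'.parent (Sum.inl i) = Sum.inl j := by
  obtain ⟨f, h1, h2, h3⟩ := h
  rw [← h1 j, ← h1 i, ← h3, f.apply_eq_iff_eq]

theorem Isomorphic.parent_eq_parent_iff {T T' : BasedTree n} (h : Isomorphic T T')
    (i j : Fin n) :
    T.parent (Sum.inl i) = T.parent (Sum.inl j) ↔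
      T'.parent (Sum.inl i) = T'.parent (Sum.inl j) := by
  obtain ⟨f, h1, h2, h3⟩ := h
  rw [← h1 j, ← h1 i, ← h3, ← h3, f.apply_eq_iff_eq]

end BasedTree

namespace Code

open BasedTree

variable {n : ℕ}

theorem fin_two_cases (t : Fin 2) : t = 0 ∨ t = 1 := by
  lia

/-- The table is closed under collapse. Each edge with a trivial endpoint matches a constructor; the
remaining edges join two named vertices, contrary to `hr`. -/
theorem exists_stepAt (c : Code n) (v : c.tree.Vertex) (hv : v ≠ c.tree.base)
    (hr : v.isRight ∨ (c.tree.parent v).isRight) : ∃ c', StepAt c v c' := by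
  cases c with
  | alpha =>
    rcases v with i | t
    · exact ⟨_, .alpha_A ⟨fun _ => i, fun _ _ _ => Subsingleton.elim _ _⟩⟩
    · exact absurd (congrArg Sum.inr (Subsingleton.elim (α := Fin 1) t 0)) hv
  | rho e =>
    rcases v with i | t
    · by_cases h0 : i = e 0
      · exact h0 ▸ ⟨_, .rho_beta e⟩
      by_cases h1 : i = e 1
      · exact h1 ▸ ⟨_, .rho_beta' e⟩
      obtain ⟨e, rfl, rfl⟩ := exists_cons e (Fin.forall_fin_two.2 ⟨h0, h1⟩) ![1, 2] (by decide)
        (by decide)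
      exact ⟨_, .rho_gamma e⟩
    · obtain rfl | rfl := fin_two_cases t
      · exact absurd rfl hv
      · exact ⟨_, .rho_alpha e⟩
  | tau e =>
    rcases v with i | t
    · by_cases h0 : i = e 0
      · exact h0 ▸ ⟨_, .tau_gamma e⟩
      by_cases h1 : i = e 1
      · simp [tree, BasedTree.tau, ofDepthTwo, h1] at hr
      by_cases h2 : i = e 2
      · exact h2 ▸ ⟨_, .tau_epsilon e⟩
      by_cases h3 : i = e 3
      · exact h3 ▸ ⟨_, .tau_epsilon' e⟩
      obtain ⟨e, rfl, rfl⟩ := exists_cons e (i := i) (by simp [Fin.forall_fin_succ, *])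
        ![1, 2, 3, 4] (by decide) (by decide)
      exact ⟨_, .tau_delta e⟩
    · obtain rfl | rfl := fin_two_cases t
      · exact absurd rfl hv
      · exact ⟨_, .tau_beta e⟩
  | sigma e =>
    rcases v with i | t
    · by_cases h1 : i = e 1
      · exact h1 ▸ ⟨_, .sigma_delta e⟩
      by_cases h2 : i = e 2
      · exact h2 ▸ ⟨_, .sigma_delta₂ e⟩
      by_cases h3 : i = e 3
      · exact h3 ▸ ⟨_, .sigma_delta₃ e⟩
      by_cases h4 : i = e 4
      · exact h4 ▸ ⟨_, .sigma_delta₄ e⟩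
      simp [tree, BasedTree.sigma, ofDepthTwo, *] at hr
    · obtain rfl | rfl := fin_two_cases t
      · exact ⟨_, .sigma_gamma' e⟩
      · exact ⟨_, .sigma_gamma e⟩
  | beta e =>
    rcases v with i | t
    · by_cases h0 : i = e 0
      · exact h0 ▸ ⟨_, .beta_A e⟩
      by_cases h1 : i = e 1
      · simp [tree, BasedTree.beta, ofDepthTwo, h1] at hr
      obtain ⟨e, rfl, rfl⟩ := exists_cons e (Fin.forall_fin_two.2 ⟨h0, h1⟩) ![1, 2] (by decide)
        (by decide)
      exact ⟨_, .beta_B e⟩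
    · exact absurd (congrArg Sum.inr (Subsingleton.elim (α := Fin 1) t 0)) hv
  | gamma e =>
    rcases v with i | t
    · by_cases h1 : i = e 1
      · exact h1 ▸ ⟨_, .gamma_B e⟩
      by_cases h2 : i = e 2
      · exact h2 ▸ ⟨_, .gamma_B' e⟩
      simp [tree, BasedTree.gamma, ofDepthTwo, *] at hr
    · obtain rfl : t = (0 : Fin 1) := Subsingleton.elim (α := Fin 1) _ _
      exact ⟨_, .gamma_A e⟩
  | delta e =>
    rcases v with i | t
    · by_cases h3 : i = e 3
      · exact h3 ▸ ⟨_, .delta_C e⟩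
      by_cases h4 : i = e 4
      · exact h4 ▸ ⟨_, .delta_C' e⟩
      simp [tree, BasedTree.delta, ofDepthTwo, *] at hr
      split_ifs at hr <;> simp at hr
    · obtain rfl : t = (0 : Fin 1) := Subsingleton.elim (α := Fin 1) _ _
      exact ⟨_, .delta_B e⟩
  | epsilon e =>
    rcases v with i | t
    · by_cases h0 : i = e 0
      · exact h0 ▸ ⟨_, .epsilon_B e⟩
      by_cases h1 : i = e 1
      · simp [tree, BasedTree.epsilon, ofDepthTwo, h1] at hr
      by_cases h2 : i = e 2
      · exact h2 ▸ ⟨_, .epsilon_B' e⟩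
      by_cases h3 : i = e 3
      · simp [tree, BasedTree.epsilon, ofDepthTwo, h3] at hr
      obtain ⟨e, rfl, rfl⟩ := exists_cons e (i := i) (by simp [Fin.forall_fin_succ, *])
        ![1, 2, 3, 4] (by decide) (by decide)
      exact ⟨_, .epsilon_C e⟩
    · exact absurd (congrArg Sum.inr (Subsingleton.elim (α := Fin 1) t 0)) hv
  | A e =>
    rcases v with i | t
    · simp [tree, BasedTree.A, ofDepthTwo] at hr
    · exact Fin.elim0 t
  | B e =>
    rcases v with i | t
    · simp [tree, BasedTree.B, ofDepthTwo] at hr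
      split_ifs at hr <;> simp at hr
    · exact Fin.elim0 t
  | C e =>
    rcases v with i | t
    · simp [tree, BasedTree.C, ofDepthTwo] at hr
      split_ifs at hr <;> simp at hr
    · exact Fin.elim0 t

/-- The name of the basepoint. -/
def base : Code n → Option (Fin n)
  | alpha | rho _ | beta _ | tau _ | epsilon _ => none
  | A e => some (e 0)
  | gamma e | B e => some (e 0)
  | sigma e | delta e | C e => some (e 0)

/-- The pairs `(i, j)` such that `i` is not the basepoint and is adjacent to the leaf `j`. -/
def arrows : Code n → Finset (Fin n × Fin n)
  | alpha | A _ | rho _ | gamma _ | sigma _ => ∅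
  | beta e => {(e 0, e 1)}
  | tau e => {(e 0, e 1)}
  | B e => {(e 1, e 2)}
  | delta e => {(e 1, e 2)}
  | epsilon e => {(e 0, e 1), (e 2, e 3)}
  | C e => {(e 1, e 2), (e 3, e 4)}

/-- The pairs of leaves of the trivial vertices other than the basepoint. -/
def pairs : Code n → Finset (Sym2 (Fin n))
  | alpha | A _ | beta _ | B _ | epsilon _ | C _ => ∅
  | rho e => {s(e 0, e 1)}
  | gamma e => {s(e 1, e 2)}
  | sigma e => {s(e 1, e 2), s(e 3, e 4)}
  | tau e => {s(e 2, e 3)}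
  | delta e => {s(e 3, e 4)}

theorem base_eq_some_iff (c : Code n) (i : Fin n) : c.base = some i ↔ c.tree.base = Sum.inl i := by
  cases c <;>
    simp [base, tree, ofDepthTwo, BasedTree.alpha, BasedTree.A, BasedTree.rho, BasedTree.beta,
      BasedTree.gamma, BasedTree.B, BasedTree.sigma, BasedTree.tau, BasedTree.delta,
      BasedTree.epsilon, BasedTree.C]

/-- Expresses the arrows through `parent`, `base` and names alone, hence in a form invariant under
isomorphism; `mem_pairs` does the same for pairs. -/
theorem mem_arrows (c : Code n) (i j : Fin n) :
    (i, j) ∈ c.arrows ↔ c.tree.parent (Sum.inl j) = Sum.inl i ∧ c.tree.base ≠ Sum.inl i := by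
  cases c with
  | alpha | A e => simp [arrows, tree, ofDepthTwo, BasedTree.alpha, BasedTree.A]
  | rho e | beta e =>
    have := ne2 e
    simp [arrows, tree, ofDepthTwo, BasedTree.rho, BasedTree.beta]
    grind
  | gamma e | B e =>
    have := ne3 e
    simp [arrows, tree, ofDepthTwo, BasedTree.gamma, BasedTree.B]
    grind
  | tau e | epsilon e =>
    have := ne4 e
    simp [arrows, tree, ofDepthTwo, BasedTree.tau, BasedTree.epsilon]
    grind
  | sigma e | delta e | C e =>
    have := ne5 e
    simp [arrows, tree, ofDepthTwo, BasedTree.sigma, BasedTree.delta, BasedTree.C]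
    grind

theorem mem_pairs (c : Code n) (i j : Fin n) :
    s(i, j) ∈ c.pairs ↔ i ≠ j ∧ c.tree.parent (Sum.inl i) = c.tree.parent (Sum.inl j) ∧
      c.tree.parent (Sum.inl i) ≠ c.tree.base ∧ ∀ k, c.tree.parent (Sum.inl i) ≠ Sum.inl k := by
  cases c with
  | alpha | A e => simp [pairs, tree, ofDepthTwo, BasedTree.alpha, BasedTree.A]
  | rho e | beta e =>
    have := ne2 e
    simp [pairs, tree, ofDepthTwo, BasedTree.rho, BasedTree.beta]
    grind
  | gamma e | B e =>
    have := ne3 e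
    simp [pairs, tree, ofDepthTwo, BasedTree.gamma, BasedTree.B]
    grind
  | tau e | epsilon e =>
    have := ne4 e
    simp [pairs, tree, ofDepthTwo, BasedTree.tau, BasedTree.epsilon]
    grind
  | sigma e | delta e | C e =>
    have := ne5 e
    simp [pairs, tree, ofDepthTwo, BasedTree.sigma, BasedTree.delta, BasedTree.C]
    grind

/-- Whether the basepoint is named, and the numbers of arrows and pairs. -/
def signature : Code n → Bool × ℕ × ℕ
  | alpha => (false, 0, 0)
  | A _ => (true, 0, 0)
  | rho _ => (false, 0, 1)
  | beta _ => (false, 1, 0)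
  | gamma _ => (true, 0, 1)
  | B _ => (true, 1, 0)
  | sigma _ => (true, 0, 2)
  | tau _ => (false, 1, 1)
  | delta _ => (true, 1, 1)
  | epsilon _ => (false, 2, 0)
  | C _ => (true, 2, 0)

theorem signature_eq (c : Code n) :
    c.signature = (c.base.isSome, c.arrows.card, c.pairs.card) := by
  cases c with
  | epsilon e | C e | sigma e =>
    simp [signature, base, arrows, pairs]
  | _ => rfl

/-- The changes of parameters that do not change the tree. -/
inductive Sym : Code n → Code n → Prop
  | refl (c : Code n) : Sym c c
  | rho (e : Fin 2 ↪ Fin n) : Sym (rho e) (rho (sel e ![1, 0]))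
  | gamma (e : Fin 3 ↪ Fin n) : Sym (gamma e) (gamma (sel e ![0, 2, 1]))
  | sigma₁ (e : Fin 5 ↪ Fin n) : Sym (sigma e) (sigma (sel e ![0, 2, 1, 3, 4]))
  | sigma₂ (e : Fin 5 ↪ Fin n) : Sym (sigma e) (sigma (sel e ![0, 1, 2, 4, 3]))
  | sigma₃ (e : Fin 5 ↪ Fin n) : Sym (sigma e) (sigma (sel e ![0, 2, 1, 4, 3]))
  | sigma₄ (e : Fin 5 ↪ Fin n) : Sym (sigma e) (sigma (sel e ![0, 3, 4, 1, 2]))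
  | sigma₅ (e : Fin 5 ↪ Fin n) : Sym (sigma e) (sigma (sel e ![0, 4, 3, 1, 2]))
  | sigma₆ (e : Fin 5 ↪ Fin n) : Sym (sigma e) (sigma (sel e ![0, 3, 4, 2, 1]))
  | sigma₇ (e : Fin 5 ↪ Fin n) : Sym (sigma e) (sigma (sel e ![0, 4, 3, 2, 1]))
  | tau (e : Fin 4 ↪ Fin n) : Sym (tau e) (tau (sel e ![0, 1, 3, 2]))
  | delta (e : Fin 5 ↪ Fin n) : Sym (delta e) (delta (sel e ![0, 1, 2, 4, 3]))
  | epsilon (e : Fin 4 ↪ Fin n) : Sym (epsilon e) (epsilon (sel e ![2, 3, 0, 1]))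
  | C (e : Fin 5 ↪ Fin n) : Sym (C e) (C (sel e ![0, 3, 4, 1, 2]))

theorem pair_eq_pair {α : Type*} [DecidableEq α] {a b c d : α}
    (h : ({a, b} : Finset α) = {c, d}) : a = c ∧ b = d ∨ a = d ∧ b = c := by
  rwa [← Finset.coe_inj, Finset.coe_pair, Finset.coe_pair, Set.pair_eq_pair_iff] at h

/-- Basepoint, arrows and pairs are invariants. Their signatures separate the eleven families, and
within a family they determine the parameters up to the swaps of unordered data. -/
theorem sym_of_isomorphic {c c' : Code n} (h : Isomorphic c.tree c'.tree) : Sym c c' := by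
  have hb : c.base = c'.base := by
    ext i
    simp only [base_eq_some_iff, h.base_eq_iff]
  have ha : c.arrows = c'.arrows := by
    ext ⟨i, j⟩
    simp only [mem_arrows, h.parent_eq_iff, Ne, h.base_eq_iff]
  have hp : c.pairs = c'.pairs := by
    ext p
    induction p using Sym2.ind with
    | _ i j => simp only [mem_pairs, h.parent_eq_parent_iff, h.parent_eq_iff,
        h.parent_eq_base_iff, Ne]
  have hs : c.signature = c'.signature := by
    rw [signature_eq, signature_eq, hb, ha, hp]
  have key : ∀ {k : ℕ} {e e' : Fin k ↪ Fin n}, (∀ i, e i = e' i) → e = e' :=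
    fun h => DFunLike.ext _ _ h
  cases c <;> cases c' <;> first | (simp [signature] at hs; done) | skip
  case alpha.alpha => exact .refl _
  case A.A e e' =>
    obtain rfl : e = e' := key (by simpa [base, Fin.forall_fin_succ] using hb)
    exact .refl _
  case rho.rho e e' =>
    rcases Sym2.eq_iff.1 (Finset.singleton_injective hp) with h | h
    · obtain rfl : e' = e := key (by simp [Fin.forall_fin_succ, h])
      exact .refl _
    · obtain rfl : e' = sel e ![1, 0] := key (by simp [Fin.forall_fin_succ, sel_apply, h])
      exact .rho _
  case beta.beta e e' =>
    have h := Prod.mk.inj (Finset.singleton_injective ha)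
    obtain rfl : e' = e := key (by simp [Fin.forall_fin_succ, h])
    exact .refl _
  case gamma.gamma e e' =>
    have h0 := Option.some.inj hb
    rcases Sym2.eq_iff.1 (Finset.singleton_injective hp) with h | h
    · obtain rfl : e' = e := key (by simp [Fin.forall_fin_succ, h, h0])
      exact .refl _
    · obtain rfl : e' = sel e ![0, 2, 1] := key (by simp [Fin.forall_fin_succ, sel_apply, h, h0])
      exact .gamma _
  case B.B e e' =>
    have h0 := Option.some.inj hb
    have h := Prod.mk.inj (Finset.singleton_injective ha)
    obtain rfl : e' = e := key (by simp [Fin.forall_fin_succ, h, h0])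
    exact .refl _
  case tau.tau e e' =>
    have h0 := Prod.mk.inj (Finset.singleton_injective ha)
    rcases Sym2.eq_iff.1 (Finset.singleton_injective hp) with h | h
    · obtain rfl : e' = e := key (by simp [Fin.forall_fin_succ, h, h0])
      exact .refl _
    · obtain rfl : e' = sel e ![0, 1, 3, 2] :=
        key (by simp [Fin.forall_fin_succ, sel_apply, h, h0])
      exact .tau _
  case delta.delta e e' =>
    have h0 := Option.some.inj hb
    have h1 := Prod.mk.inj (Finset.singleton_injective ha)
    rcases Sym2.eq_iff.1 (Finset.singleton_injective hp) with h | h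
    · obtain rfl : e' = e := key (by simp [Fin.forall_fin_succ, h, h0, h1])
      exact .refl _
    · obtain rfl : e' = sel e ![0, 1, 2, 4, 3] :=
        key (by simp [Fin.forall_fin_succ, sel_apply, h, h0, h1])
      exact .delta _
  case epsilon.epsilon e e' =>
    rcases pair_eq_pair ha with h | h <;> simp only [Prod.mk.injEq] at h
    · obtain rfl : e' = e := key (by simp [Fin.forall_fin_succ, h])
      exact .refl _
    · obtain rfl : e' = sel e ![2, 3, 0, 1] := key (by simp [Fin.forall_fin_succ, sel_apply, h])
      exact .epsilon _
  case C.C e e' =>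
    have h0 := Option.some.inj hb
    rcases pair_eq_pair ha with h | h <;> simp only [Prod.mk.injEq] at h
    · obtain rfl : e' = e := key (by simp [Fin.forall_fin_succ, h, h0])
      exact .refl _
    · obtain rfl : e' = sel e ![0, 3, 4, 1, 2] :=
        key (by simp [Fin.forall_fin_succ, sel_apply, h, h0])
      exact .C _
  case sigma.sigma e e' =>
    have h0 := Option.some.inj hb
    rcases pair_eq_pair hp with ⟨h1, h2⟩ | ⟨h1, h2⟩ <;>
      rcases Sym2.eq_iff.1 h1 with h1 | h1 <;> rcases Sym2.eq_iff.1 h2 with h2 | h2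
    · obtain rfl : e' = e := key (by simp [Fin.forall_fin_succ, h0, h1, h2])
      exact .refl _
    · obtain rfl : e' = sel e ![0, 1, 2, 4, 3] :=
        key (by simp [Fin.forall_fin_succ, sel_apply, h0, h1, h2])
      exact .sigma₂ _
    · obtain rfl : e' = sel e ![0, 2, 1, 3, 4] :=
        key (by simp [Fin.forall_fin_succ, sel_apply, h0, h1, h2])
      exact .sigma₁ _
    · obtain rfl : e' = sel e ![0, 2, 1, 4, 3] :=
        key (by simp [Fin.forall_fin_succ, sel_apply, h0, h1, h2])
      exact .sigma₃ _
    · obtain rfl : e' = sel e ![0, 3, 4, 1, 2] :=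
        key (by simp [Fin.forall_fin_succ, sel_apply, h0, h1, h2])
      exact .sigma₄ _
    · obtain rfl : e' = sel e ![0, 4, 3, 1, 2] :=
        key (by simp [Fin.forall_fin_succ, sel_apply, h0, h1, h2])
      exact .sigma₅ _
    · obtain rfl : e' = sel e ![0, 3, 4, 2, 1] :=
        key (by simp [Fin.forall_fin_succ, sel_apply, h0, h1, h2])
      exact .sigma₆ _
    · obtain rfl : e' = sel e ![0, 4, 3, 2, 1] :=
        key (by simp [Fin.forall_fin_succ, sel_apply, h0, h1, h2])
      exact .sigma₇ _

end Code

/-! ### The collapse order on codes, and propagation of a relation through triangles. -/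

namespace Code

open BasedTree Relation

variable {n : ℕ}

/-- The tree `c'` is obtained from the tree `c` by the collapse of an edge. -/
def Step (c c' : Code n) : Prop := ∃ v, StepAt c v c'

/-- The tree `c` collapses to a tree that is isomorphic to `c'`. -/
def Below (c c' : Code n) : Prop :=
  ∃ d, ReflTransGen Step c d ∧ Isomorphic d.tree c'.tree

theorem isCollapse_of_reflTransGen {c c' : Code n} (h : ReflTransGen Step c c') :
    IsCollapse c.tree c'.tree :=
  h.lift tree fun _ _ ⟨v, hv⟩ => isEdgeCollapse_iff.2 ⟨v, hv.collapseAt⟩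

/-- Each collapse of a tree can be imitated on codes: `exists_stepAt` supplies the code of the
collapsed tree and `CollapseAt.unique` the isomorphism. -/
theorem exists_reflTransGen {c : Code n} {T T' : BasedTree n} (hc : Isomorphic c.tree T)
    (h : IsCollapse T T') : ∃ d, ReflTransGen Step c d ∧ Isomorphic d.tree T' := by
  induction h with
  | refl => exact ⟨c, .refl, hc⟩
  | tail _ h ih =>
    obtain ⟨d, hd, hi⟩ := ih
    obtain ⟨f, hf⟩ := hi.symm
    obtain ⟨e, he⟩ := isEdgeCollapse_iff.1 h
    have h' := he.of_isIso hf
    obtain ⟨d', hd'⟩ := exists_stepAt d (f e) h'.choose_spec.1 h'.choose_spec.2.1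
    exact ⟨d', hd.tail ⟨_, hd'⟩, hd'.collapseAt.unique h'⟩

theorem Below.trans {c c' c'' : Code n} (h : Below c c') (h' : Below c' c'') : Below c c'' := by
  obtain ⟨d, hd, hi⟩ := h
  obtain ⟨d', hd', hi'⟩ := h'
  obtain ⟨d'', hd'', hi''⟩ := exists_reflTransGen hi (isCollapse_of_reflTransGen hd')
  exact ⟨d'', hd.trans hd'', hi''.trans hi'⟩

theorem StepAt.below {c c' : Code n} {v : c.tree.Vertex} (h : StepAt c v c') : Below c c' :=
  ⟨c', .single ⟨v, h⟩, .refl _⟩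

theorem below_of_isomorphic {c c' : Code n} (h : Isomorphic c.tree c'.tree) : Below c c' :=
  ⟨c, .refl, h⟩

/-- One of the trees collapses to the other one. -/
def Comparable (c c' : Code n) : Prop := Below c c' ∨ Below c' c

theorem Comparable.symm {c c' : Code n} (h : Comparable c c') : Comparable c' c :=
  Or.symm h

theorem sel_sel {k l m : ℕ} (e : Fin m ↪ Fin n) {s : Fin l → Fin m} {hs : Function.Injective s}
    {t : Fin k → Fin l} {ht : Function.Injective t} (r : Fin k → Fin m)
    (h : ∀ i, s (t i) = r i := by decide) (hr : Function.Injective r := by decide) :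
    sel (sel e s hs) t ht = sel e r hr :=
  DFunLike.ext _ _ fun i => congrArg e (h i)

theorem tree_gamma_swap (e : Fin 3 ↪ Fin n) :
    (gamma e).tree = (gamma (sel e ![0, 2, 1])).tree := by
  simp [tree, BasedTree.gamma, sel_apply, or_comm]

theorem tree_tau_swap (e : Fin 4 ↪ Fin n) :
    (tau e).tree = (tau (sel e ![0, 1, 3, 2])).tree := by
  simp [tree, BasedTree.tau, sel_apply, or_comm]

theorem tree_delta_swap (e : Fin 5 ↪ Fin n) :
    (delta e).tree = (delta (sel e ![0, 1, 2, 4, 3])).tree := by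
  simp [tree, BasedTree.delta, sel_apply, or_comm]

/-- A relation that is satisfied on a spanning tree of the complex of trees and that propagates
along triangles. -/
structure Propagates (E : Code n → Code n → Prop) : Prop where
  refl (c : Code n) : E c c
  symm {c c' : Code n} : E c c' → E c' c
  trans {c c' c'' : Code n} : Comparable c c' → Comparable c' c'' → Comparable c c'' →
    E c c' → E c' c'' → E c c''
  alpha_A (e : Fin 1 ↪ Fin n) : E alpha (A e)
  beta_A (e : Fin 2 ↪ Fin n) : E (beta e) (A (sel e ![0]))
  gamma_A (e : Fin 3 ↪ Fin n) : E (gamma e) (A (sel e ![0]))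
  gamma_B (e : Fin 3 ↪ Fin n) : E (gamma e) (B e)
  delta_B (e : Fin 5 ↪ Fin n) : E (delta e) (B (sel e ![0, 1, 2]))
  delta_C (e : Fin 5 ↪ Fin n) : E (delta e) (C e)
  epsilon_B' (e : Fin 4 ↪ Fin n) : E (epsilon e) (B (sel e ![2, 0, 1]))
  rho_alpha (e : Fin 2 ↪ Fin n) : E (rho e) alpha
  sigma_gamma (e : Fin 5 ↪ Fin n) : E (sigma e) (gamma (sel e ![0, 1, 2]))
  tau_beta (e : Fin 4 ↪ Fin n) : E (tau e) (beta (sel e ![0, 1]))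

namespace Propagates

variable {E : Code n → Code n → Prop}

/-- In a chain of collapses `p`, `q`, `r`, two sides of the triangle give the third. The names of
this and the next two lemmas indicate the side obtained. -/
theorem top_bot (hE : Propagates E) {p q r : Code n} (h : Below p q) (h' : Below q r)
    (h1 : E p q) (h2 : E q r) :
    E p r :=
  hE.trans (.inl h) (.inl h') (.inl (h.trans h')) h1 h2

theorem mid_bot (hE : Propagates E) {p q r : Code n} (h : Below p q) (h' : Below q r)
    (h1 : E p q) (h2 : E p r) :
    E q r :=
  hE.trans (.inr h) (.inl (h.trans h')) (.inl h') (hE.symm h1) h2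

theorem top_mid (hE : Propagates E) {p q r : Code n} (h : Below p q) (h' : Below q r)
    (h1 : E p r) (h2 : E q r) :
    E p q :=
  hE.trans (.inl (h.trans h')) (.inr h') (.inl h) h1 (hE.symm h2)

/-- Two codes of the same tree form a degenerate triangle with their common collapse `A`. -/
theorem gamma_gamma (hE : Propagates E) (e : Fin 3 ↪ Fin n) :
    E (gamma e) (gamma (sel e ![0, 2, 1])) := by
  have h := hE.gamma_A (sel e ![0, 2, 1])
  have h' := (StepAt.gamma_A (sel e ![0, 2, 1])).below
  rw [sel_sel e ![0]] at h h'
  exact hE.top_mid (below_of_isomorphic (tree_gamma_swap e ▸ .refl _)) h' (hE.gamma_A e) h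

theorem gamma_B' (hE : Propagates E) (e : Fin 3 ↪ Fin n) : E (gamma e) (B (sel e ![0, 2, 1])) :=
  hE.top_bot (below_of_isomorphic (tree_gamma_swap e ▸ .refl _)) (StepAt.gamma_B _).below
    (hE.gamma_gamma e) (hE.gamma_B _)

theorem rho_A (hE : Propagates E) (e : Fin 2 ↪ Fin n) (e' : Fin 1 ↪ Fin n) : E (rho e) (A e') :=
  hE.top_bot (StepAt.rho_alpha e).below (StepAt.alpha_A e').below (hE.rho_alpha e) (hE.alpha_A e')

theorem rho_beta (hE : Propagates E) (e : Fin 2 ↪ Fin n) : E (rho e) (beta e) :=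
  hE.top_mid (StepAt.rho_beta e).below (StepAt.beta_A e).below (hE.rho_A _ _) (hE.beta_A e)

theorem rho_beta' (hE : Propagates E) (e : Fin 2 ↪ Fin n) : E (rho e) (beta (sel e ![1, 0])) :=
  hE.top_mid (StepAt.rho_beta' e).below (StepAt.beta_A _).below (hE.rho_A _ _) (hE.beta_A _)

theorem rho_gamma (hE : Propagates E) (e : Fin 3 ↪ Fin n) : E (rho (sel e ![1, 2])) (gamma e) :=
  hE.top_mid (StepAt.rho_gamma e).below (StepAt.gamma_A e).below (hE.rho_A _ _) (hE.gamma_A e)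

/-- The square `rho`, `beta`, `gamma`, `B` is cut by the diagonal `rho`–`B`; the half through
`gamma` settles the diagonal, the other half the edge. -/
theorem beta_B (hE : Propagates E) (e : Fin 3 ↪ Fin n) : E (beta (sel e ![1, 2])) (B e) :=
  hE.mid_bot (StepAt.rho_beta _).below (StepAt.beta_B e).below (hE.rho_beta _)
    (hE.top_bot (StepAt.rho_gamma e).below (StepAt.gamma_B e).below (hE.rho_gamma e)
      (hE.gamma_B e))

theorem sigma_A (hE : Propagates E) (e : Fin 5 ↪ Fin n) : E (sigma e) (A (sel e ![0])) := by
  have h := hE.top_bot (StepAt.sigma_gamma e).below (StepAt.gamma_A _).below (hE.sigma_gamma e)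
    (hE.gamma_A _)
  rwa [sel_sel e ![0]] at h

theorem sigma_gamma' (hE : Propagates E) (e : Fin 5 ↪ Fin n) :
    E (sigma e) (gamma (sel e ![0, 3, 4])) := by
  refine hE.top_mid (StepAt.sigma_gamma' e).below (StepAt.gamma_A _).below ?_ (hE.gamma_A _)
  rw [sel_sel e ![0]]
  exact hE.sigma_A e

theorem below_sigma_A (e : Fin 5 ↪ Fin n) : Below (sigma e) (A (sel e ![0])) := by
  have h := (StepAt.sigma_gamma e).below.trans (StepAt.gamma_A _).below
  rwa [sel_sel e ![0]] at h

/-- The diagonal `sigma`–`B` is settled through `gamma`, and then the triangle with `delta` closes.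
-/
theorem sigma_delta (hE : Propagates E) (e : Fin 5 ↪ Fin n) : E (sigma e) (delta e) :=
  hE.top_mid (StepAt.sigma_delta e).below (StepAt.delta_B e).below
    (hE.top_bot (StepAt.sigma_gamma e).below (StepAt.gamma_B _).below (hE.sigma_gamma e)
      (hE.gamma_B _)) (hE.delta_B e)

theorem sigma_delta₂ (hE : Propagates E) (e : Fin 5 ↪ Fin n) :
    E (sigma e) (delta (sel e ![0, 2, 1, 3, 4])) := by
  refine hE.top_mid (StepAt.sigma_delta₂ e).below (StepAt.delta_B _).below ?_ (hE.delta_B _)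
  have h := hE.top_bot (StepAt.sigma_gamma e).below (StepAt.gamma_B' _).below (hE.sigma_gamma e)
    (hE.gamma_B' _)
  rw [sel_sel e ![0, 2, 1]] at h ⊢
  exact h

theorem sigma_delta₃ (hE : Propagates E) (e : Fin 5 ↪ Fin n) :
    E (sigma e) (delta (sel e ![0, 3, 4, 1, 2])) := by
  refine hE.top_mid (StepAt.sigma_delta₃ e).below (StepAt.delta_B _).below ?_ (hE.delta_B _)
  have h := hE.top_bot (StepAt.sigma_gamma' e).below (StepAt.gamma_B _).below (hE.sigma_gamma' e)
    (hE.gamma_B _)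
  rw [sel_sel e ![0, 3, 4]]
  exact h

theorem sigma_delta₄ (hE : Propagates E) (e : Fin 5 ↪ Fin n) :
    E (sigma e) (delta (sel e ![0, 4, 3, 1, 2])) := by
  refine hE.top_mid (StepAt.sigma_delta₄ e).below (StepAt.delta_B _).below ?_ (hE.delta_B _)
  have h := hE.top_bot (StepAt.sigma_gamma' e).below (StepAt.gamma_B' _).below
    (hE.sigma_gamma' e) (hE.gamma_B' _)
  rw [sel_sel e ![0, 4, 3]] at h ⊢
  exact h

theorem delta_delta (hE : Propagates E) (e : Fin 5 ↪ Fin n) :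
    E (delta e) (delta (sel e ![0, 1, 2, 4, 3])) := by
  have h := hE.delta_B (sel e ![0, 1, 2, 4, 3])
  have h' := (StepAt.delta_B (sel e ![0, 1, 2, 4, 3])).below
  rw [sel_sel e ![0, 1, 2]] at h h'
  exact hE.top_mid (below_of_isomorphic (tree_delta_swap e ▸ .refl _)) h' (hE.delta_B e) h

theorem delta_C' (hE : Propagates E) (e : Fin 5 ↪ Fin n) :
    E (delta e) (C (sel e ![0, 1, 2, 4, 3])) :=
  hE.top_bot (below_of_isomorphic (tree_delta_swap e ▸ .refl _)) (StepAt.delta_C _).below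
    (hE.delta_delta e) (hE.delta_C _)

theorem tau_A (hE : Propagates E) (e : Fin 4 ↪ Fin n) : E (tau e) (A (sel e ![0])) := by
  have h := hE.top_bot (StepAt.tau_beta e).below (StepAt.beta_A _).below (hE.tau_beta e)
    (hE.beta_A _)
  rwa [sel_sel e ![0]] at h

theorem tau_gamma (hE : Propagates E) (e : Fin 4 ↪ Fin n) :
    E (tau e) (gamma (sel e ![0, 2, 3])) := by
  refine hE.top_mid (StepAt.tau_gamma e).below (StepAt.gamma_A _).below ?_ (hE.gamma_A _)
  rw [sel_sel e ![0]]
  exact hE.tau_A e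

theorem tau_delta (hE : Propagates E) (e : Fin 5 ↪ Fin n) :
    E (tau (sel e ![1, 2, 3, 4])) (delta e) := by
  refine hE.top_mid (StepAt.tau_delta e).below (StepAt.delta_B _).below ?_ (hE.delta_B _)
  have h := (StepAt.tau_beta (sel e ![1, 2, 3, 4])).below
  have h' := hE.tau_beta (sel e ![1, 2, 3, 4])
  have h1 := (StepAt.beta_B (sel e ![0, 1, 2])).below
  have h2 := hE.beta_B (sel e ![0, 1, 2])
  rw [sel_sel e ![1, 2]] at h h' h1 h2
  exact hE.top_bot h h1 h' h2

/-- Of the two edges from `epsilon` to a `B`, the spanning tree contains the one whose target also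
lies below `beta (sel e ![0, 1])`, so that `tau` reaches this `B` through `beta`. -/
theorem tau_epsilon (hE : Propagates E) (e : Fin 4 ↪ Fin n) : E (tau e) (epsilon e) := by
  refine hE.top_mid (StepAt.tau_epsilon e).below (StepAt.epsilon_B' e).below ?_ (hE.epsilon_B' e)
  have h1 := (StepAt.beta_B (sel e ![2, 0, 1])).below
  have h2 := hE.beta_B (sel e ![2, 0, 1])
  rw [sel_sel e ![0, 1]] at h1 h2
  exact hE.top_bot (StepAt.tau_beta e).below h1 (hE.tau_beta e) h2

theorem tau_tau (hE : Propagates E) (e : Fin 4 ↪ Fin n) :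
    E (tau e) (tau (sel e ![0, 1, 3, 2])) := by
  have h := hE.tau_beta (sel e ![0, 1, 3, 2])
  have h' := (StepAt.tau_beta (sel e ![0, 1, 3, 2])).below
  rw [sel_sel e ![0, 1]] at h h'
  exact hE.top_mid (below_of_isomorphic (tree_tau_swap e ▸ .refl _)) h' (hE.tau_beta e) h

theorem tau_epsilon' (hE : Propagates E) (e : Fin 4 ↪ Fin n) :
    E (tau e) (epsilon (sel e ![0, 1, 3, 2])) :=
  hE.top_bot (below_of_isomorphic (tree_tau_swap e ▸ .refl _)) (StepAt.tau_epsilon _).below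
    (hE.tau_tau e) (hE.tau_epsilon _)

/-- The other `B` below `epsilon` is reached from `tau` through `gamma`. -/
theorem epsilon_B (hE : Propagates E) (e : Fin 4 ↪ Fin n) : E (epsilon e) (B (sel e ![0, 2, 3])) :=
  hE.mid_bot (StepAt.tau_epsilon e).below (StepAt.epsilon_B e).below (hE.tau_epsilon e)
    (hE.top_bot (StepAt.tau_gamma e).below (StepAt.gamma_B _).below (hE.tau_gamma e)
      (hE.gamma_B _))

theorem epsilon_C (hE : Propagates E) (e : Fin 5 ↪ Fin n) :
    E (epsilon (sel e ![1, 2, 3, 4])) (C e) :=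
  hE.mid_bot (StepAt.tau_epsilon _).below (StepAt.epsilon_C e).below (hE.tau_epsilon _)
    (hE.top_bot (StepAt.tau_delta e).below (StepAt.delta_C e).below (hE.tau_delta e)
      (hE.delta_C e))

theorem of_stepAt (hE : Propagates E) {c c' : Code n} {v : c.tree.Vertex} (h : StepAt c v c') :
    E c c' := by
  cases h with
  | alpha_A e => exact hE.alpha_A e
  | rho_alpha e => exact hE.rho_alpha e
  | rho_beta e => exact hE.rho_beta e
  | rho_beta' e => exact hE.rho_beta' e
  | rho_gamma e => exact hE.rho_gamma e
  | beta_A e => exact hE.beta_A e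
  | beta_B e => exact hE.beta_B e
  | gamma_A e => exact hE.gamma_A e
  | gamma_B e => exact hE.gamma_B e
  | gamma_B' e => exact hE.gamma_B' e
  | sigma_gamma e => exact hE.sigma_gamma e
  | sigma_gamma' e => exact hE.sigma_gamma' e
  | sigma_delta e => exact hE.sigma_delta e
  | sigma_delta₂ e => exact hE.sigma_delta₂ e
  | sigma_delta₃ e => exact hE.sigma_delta₃ e
  | sigma_delta₄ e => exact hE.sigma_delta₄ e
  | tau_gamma e => exact hE.tau_gamma e
  | tau_beta e => exact hE.tau_beta e
  | tau_epsilon e => exact hE.tau_epsilon e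
  | tau_epsilon' e => exact hE.tau_epsilon' e
  | tau_delta e => exact hE.tau_delta e
  | delta_B e => exact hE.delta_B e
  | delta_C e => exact hE.delta_C e
  | delta_C' e => exact hE.delta_C' e
  | epsilon_B e => exact hE.epsilon_B e
  | epsilon_B' e => exact hE.epsilon_B' e
  | epsilon_C e => exact hE.epsilon_C e

theorem of_reflTransGen (hE : Propagates E) {c c' : Code n} (h : ReflTransGen Step c c') :
    E c c' := by
  induction h with
  | refl => exact hE.refl c
  | tail h h' ih =>
    obtain ⟨v, hv⟩ := h'
    exact hE.top_bot ⟨_, h, .refl _⟩ hv.below ih (hE.of_stepAt hv)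

/-- Isomorphic trees that have a common collapse are related if both are related to it. -/
theorem of_common (hE : Propagates E) {c c' d : Code n} (h : Isomorphic c.tree c'.tree)
    (hd : Below c' d)
    (h1 : E c d) (h2 : E c' d) : E c c' :=
  hE.top_mid (below_of_isomorphic h) hd h1 h2

theorem sigma_sigma (hE : Propagates E) {e e' : Fin 5 ↪ Fin n} (h : Isomorphic (sigma e).tree
    (sigma e').tree)
    (he : sel e' ![0] = sel e ![0]) : E (sigma e) (sigma e') :=
  hE.of_common h (below_sigma_A e') (he ▸ hE.sigma_A e) (hE.sigma_A e')

theorem of_isomorphic (hE : Propagates E) {c c' : Code n} (h : Isomorphic c.tree c'.tree) :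
    E c c' := by
  cases sym_of_isomorphic h with
  | refl => exact hE.refl c
  | rho e => exact hE.of_common h (StepAt.rho_alpha _).below (hE.rho_alpha e) (hE.rho_alpha _)
  | gamma e => exact hE.gamma_gamma e
  | sigma₁ e => exact hE.sigma_sigma h (sel_sel e ![0])
  | sigma₂ e => exact hE.sigma_sigma h (sel_sel e ![0])
  | sigma₃ e => exact hE.sigma_sigma h (sel_sel e ![0])
  | sigma₄ e => exact hE.sigma_sigma h (sel_sel e ![0])
  | sigma₅ e => exact hE.sigma_sigma h (sel_sel e ![0])
  | sigma₆ e => exact hE.sigma_sigma h (sel_sel e ![0])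
  | sigma₇ e => exact hE.sigma_sigma h (sel_sel e ![0])
  | tau e => exact hE.tau_tau e
  | delta e => exact hE.delta_delta e
  | epsilon e =>
    -- Exchanging the two branches exchanges the two collapses to `B`, so the tree edge of the
    -- swapped code and the derived edge `epsilon_B` of `e` end at the same code.
    have h1 := (StepAt.epsilon_B' (sel e ![2, 3, 0, 1])).below
    have h2 := hE.epsilon_B' (sel e ![2, 3, 0, 1])
    rw [sel_sel e ![0, 2, 3]] at h1 h2
    exact hE.of_common h h1 (hE.epsilon_B e) h2
  | C e =>
    -- A `C` tree has no further collapse, so the two codes are compared from above, through `sigma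
    -- e` and its two collapses `delta`.
    exact hE.mid_bot ((StepAt.sigma_delta e).below.trans (StepAt.delta_C e).below)
      (below_of_isomorphic h)
      (hE.top_bot (StepAt.sigma_delta e).below (StepAt.delta_C e).below (hE.sigma_delta e)
        (hE.delta_C e))
      (hE.top_bot (StepAt.sigma_delta₃ e).below (StepAt.delta_C _).below (hE.sigma_delta₃ e)
        (hE.delta_C _))

theorem of_below (hE : Propagates E) {c c' : Code n} (h : Below c c') : E c c' := by
  obtain ⟨d, hd, hi⟩ := h
  exact hE.top_bot ⟨d, hd, .refl _⟩ (below_of_isomorphic hi) (hE.of_reflTransGen hd)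
    (hE.of_isomorphic hi)

theorem of_comparable (hE : Propagates E) {c c' : Code n} (h : Comparable c c') : E c c' :=
  h.elim hE.of_below fun h => hE.symm (hE.of_below h)

end Propagates

end Code

/-! ### Global sections over the codes, and the passage to `domainD`. -/

namespace Code

open BasedTree Relation

variable {n : ℕ}

/-- A relation between the fibres of a family over the trees that can be lifted along comparable
trees and is compatible with triangles has a global section. -/
theorem exists_section {F : Code n → Type*} {R : ∀ c c', F c → F c' → Prop}
    (symm : ∀ {c c' f g}, R c c' f g → R c' c g f)
    (lift : ∀ {c c'}, Comparable c c' → ∀ f, ∃ g, R c c' f g)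
    (trans : ∀ {c c' c'' f g h}, Comparable c c' → Comparable c' c'' → Comparable c c'' →
      R c c' f g → R c' c'' g h → R c c'' f h) (a : F alpha) :
    ∃ k : ∀ c, F c, ∀ c c', Comparable c c' → R c c' (k c) (k c') := by
  have down : ∀ {c c' : Code n} {v}, StepAt c v c' → ∀ f, ∃ g, R c c' f g :=
    fun h => lift (.inl h.below)
  have up : ∀ {c c' : Code n} {v}, StepAt c v c' → ∀ g, ∃ f, R c c' f g := fun h g =>
    (lift (.inr h.below) g).imp fun _ => symm
  -- Transport along the spanning tree rooted at `alpha`: every other code receives its value along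
  -- exactly one edge, so no compatibility is needed yet.
  choose kA hA using fun e => down (StepAt.alpha_A e) a
  choose kbeta hbeta using fun e => up (StepAt.beta_A e) (kA _)
  choose kgamma hgamma using fun e => up (StepAt.gamma_A e) (kA _)
  choose kB hB using fun e => down (StepAt.gamma_B e) (kgamma e)
  choose kdelta hdelta using fun e => up (StepAt.delta_B e) (kB _)
  choose kC hC using fun e => down (StepAt.delta_C e) (kdelta e)
  choose kepsilon hepsilon using fun e => up (StepAt.epsilon_B' e) (kB _)
  choose krho hrho using fun e => up (StepAt.rho_alpha e) a
  choose ksigma hsigma using fun e => up (StepAt.sigma_gamma e) (kgamma _)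
  choose ktau htau using fun e => up (StepAt.tau_beta e) (kbeta _)
  let k : ∀ c, F c
    | alpha => a
    | A e => kA e
    | rho e => krho e
    | beta e => kbeta e
    | gamma e => kgamma e
    | B e => kB e
    | sigma e => ksigma e
    | tau e => ktau e
    | delta e => kdelta e
    | epsilon e => kepsilon e
    | C e => kC e
  have hE : Propagates fun c c' => R c c' (k c) (k c') :=
    { refl := fun c => by
        -- Reflexivity comes from going to some related element over `c` and back along a degenerate
        -- triangle.
        have hc : Comparable c c := .inl (below_of_isomorphic (.refl _))
        obtain ⟨g, hg⟩ := lift hc (k c)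
        exact trans hc hc hc hg (symm hg)
      symm := symm
      trans := trans
      alpha_A := hA
      beta_A := hbeta
      gamma_A := hgamma
      gamma_B := hB
      delta_B := hdelta
      delta_C := hC
      epsilon_B' := hepsilon
      rho_alpha := hrho
      sigma_gamma := hsigma
      tau_beta := htau }
  exact ⟨k, fun c c' => hE.of_comparable⟩

variable {G : Type*} [Group G] {S : Fin n → Subgroup G}

theorem isFreeFactorSplitting_self (hS : IsInternalFreeProduct S) : IsFreeFactorSplitting S S :=
  ⟨fun i => ⟨1, by
    ext x
    simp [LabelledTree.mem_conjSubgroup]⟩, hS⟩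

/-- The tree with the given name, labelled by the given free factors. -/
def labelled (hS : IsInternalFreeProduct S) (c : Code n) : LabelledTree S :=
  ⟨c.tree, c.inTable_tree, S, isFreeFactorSplitting_self hS⟩

/-- The vertex of the fundamental domain with the given name. -/
def vertex (hS : IsInternalFreeProduct S) (c : Code n) : CVertex S :=
  ⟦c.labelled hS⟧

theorem vertex_mem (hS : IsInternalFreeProduct S) (c : Code n) : c.vertex hS ∈ domainVertices S :=
  ⟨_, rfl, rfl⟩

theorem exists_vertex_eq (hS : IsInternalFreeProduct S) {w : CVertex S}
    (hw : w ∈ domainVertices S) :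
    ∃ c : Code n, c.vertex hS = w := by
  obtain ⟨⟨T, hT, L, hL⟩, rfl, hLS⟩ := hw
  obtain rfl : L = S := hLS
  obtain ⟨c, rfl⟩ := exists_tree_eq hT
  exact ⟨c, rfl⟩

theorem isomorphic_of_vertex_eq (hS : IsInternalFreeProduct S) {c : Code n} {P : LabelledTree S}
    (h : (⟦P⟧ : CVertex S) = c.vertex hS) : Isomorphic P.tree c.tree := by
  obtain ⟨f, hf, -⟩ := Quotient.exact h
  exact ⟨f, hf⟩

/-- An isomorphism preserves names and trivial vertices, hence vertex groups, so all conjugators can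
be 1. -/
theorem vertex_eq_of_isomorphic (hS : IsInternalFreeProduct S) {c c' : Code n}
    (h : Isomorphic c.tree c'.tree) :
    c.vertex hS = c'.vertex hS := by
  obtain ⟨f, hf⟩ := h
  have hv : ∀ v, (c'.labelled hS).vertexGroup (f v) = (c.labelled hS).vertexGroup v := by
    rintro (i | t)
    · exact congrArg (c'.labelled hS).vertexGroup (hf.map_named i)
    · rcases hw : f (Sum.inr t) with i | t'
      · rw [← hf.map_named, f.apply_eq_iff_eq] at hw
        cases hw
      · rfl
  refine Quotient.sound ⟨f, hf, fun _ => 1, fun v => ?_, fun v _ => by simp⟩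
  ext x
  rw [LabelledTree.mem_conjSubgroup, one_mul, inv_one, mul_one, ← hv v]
  rfl

/-- The representatives of a collapse may carry other labels, but equivalence preserves the
isomorphism type of the tree, which alone decides the relation. Conversely a collapse of trees lifts
with the labels `S` kept fixed. -/
theorem collapsesTo_vertex_iff (hS : IsInternalFreeProduct S) {c c' : Code n} :
    CollapsesTo (c.vertex hS) (c'.vertex hS) ↔ Below c c' := by
  constructor
  · rintro ⟨P, Q, hP, hQ, h, -⟩
    obtain ⟨d, hd, hi⟩ := exists_reflTransGen (isomorphic_of_vertex_eq hS hP).symm h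
    exact ⟨d, hd, hi.trans (isomorphic_of_vertex_eq hS hQ)⟩
  · rintro ⟨d, hd, hi⟩
    exact ⟨c.labelled hS, d.labelled hS, rfl, vertex_eq_of_isomorphic hS hi,
      isCollapse_of_reflTransGen hd, rfl⟩

open Classical in
theorem mem_faces_of_comparable (hS : IsInternalFreeProduct S) {c c' c'' : Code n}
    (h : Comparable c c')
    (h' : Comparable c' c'') (h'' : Comparable c c'') :
    {c.vertex hS, c'.vertex hS, c''.vertex hS} ∈ (domainD S).faces := by
  have hC : ∀ {d d' : Code n}, Comparable d d' → CollapsesTo (d.vertex hS) (d'.vertex hS) ∨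
      CollapsesTo (d'.vertex hS) (d.vertex hS) := fun h => by
    rwa [collapsesTo_vertex_iff, collapsesTo_vertex_iff]
  refine ⟨⟨by simp, Finset.card_le_three, ?_⟩, ?_⟩
  · intro v hv w hw hvw
    simp only [Finset.coe_insert, Finset.coe_singleton, Set.mem_insert_iff,
      Set.mem_singleton_iff] at hv hw
    rcases hv with rfl | rfl | rfl <;> rcases hw with rfl | rfl | rfl <;>
      first
      | exact absurd rfl hvw
      | exact hC ‹_›
      | exact (hC ‹_›).symm
  · intro v hv
    simp only [Finset.mem_insert, Finset.mem_singleton] at hv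
    rcases hv with rfl | rfl | rfl <;> exact vertex_mem hS _

theorem comparable_of_mem_face (hS : IsInternalFreeProduct S) {s : Finset (CVertex S)}
    (hs : s ∈ (domainD S).faces)
    {c c' : Code n} (hc : c.vertex hS ∈ s) (hc' : c'.vertex hS ∈ s) : Comparable c c' := by
  by_cases h : c.vertex hS = c'.vertex hS
  · exact .inl (below_of_isomorphic (isomorphic_of_vertex_eq hS h))
  · have : CollapsesTo _ _ ∨ CollapsesTo _ _ := hs.1.2.2 hc hc' h
    rwa [collapsesTo_vertex_iff, collapsesTo_vertex_iff] at this

theorem finite_faces (hS : IsInternalFreeProduct S) : (domainD S).faces.Finite := by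
  have hf : (Set.range (vertex hS)).Finite := Set.finite_range _
  refine (hf.toFinset.powerset.finite_toSet).subset fun s hs => ?_
  rw [Finset.mem_coe, Finset.mem_powerset]
  intro v hv
  rw [Set.Finite.mem_toFinset]
  exact exists_vertex_eq hS (hs.2 v hv)

end Code

theorem mainTheorem9 {G : Type*} [Group G] {n : ℕ} (hn : 5 ≤ n) (S : Fin n → Subgroup G)
    (hS : IsInternalFreeProduct S) (hnt : ∀ i, S i ≠ ⊥) :
    SimplyConnectedSpace (Realization (domainD S)) := by
  classical
  have hface : ∀ {c c' : Code n}, Code.Comparable c c' →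
      {c.vertex hS, c'.vertex hS} ∈ (domainD S).faces := fun {c c'} h => by
    have hc : Code.Comparable c' c' := .inl (Code.below_of_isomorphic (.refl _))
    simpa using Code.mem_faces_of_comparable hS h hc h
  refine Realization.simplyConnectedSpace_of_sections (Code.finite_faces hS) (v := Code.vertex hS)
    (fun c => ?_) (fun s hs w hw => Code.exists_vertex_eq hS (hs.2 w hw)) Code.alpha
    fun F R symm lift trans a => ?_
  · have hc : Code.Comparable c c := .inl (Code.below_of_isomorphic (.refl _))
    simpa using hface hc
  -- Pairwise comparable codes give faces, which supplies transport and triangles; conversely faces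
  -- give comparable codes, which makes the section compatible on all edges.
  · obtain ⟨k, hk⟩ := Code.exists_section (R := R) symm
      (fun h => lift (by convert hface h))
      (fun h h' h'' => trans (by convert Code.mem_faces_of_comparable hS h h' h'')) a
    exact ⟨k, fun c c' h => hk c c' (Code.comparable_of_mem_face hS h (by simp) (by simp))⟩
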